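/- **Theorem 5.1.** Let $\mathcal V$ be a semicartesian symmetric monoidal category (its unit object $1_{\mathcal V}$ is terminal), let $\mathcal A$ be a closed symmetric monoidal abelian category with unit $1_{\mathcal A}$ and internal hom $[-,-]$, let $\Sigma\colon\mathcal V\to\mathcal A$ be a strong symmetric monoidal functor, and let $X$ be a $\mathcal V$-category such that for every $k\ge 0$ the direct sum $$B_k=C_k^\Sigma(X)=\bigoplus_{x_0,\dots,x_k}\Sigma X(x_0,x_1)\otimes\cdots\otimes\Sigma X(x_{k-1},x_k)$$ over all tuples of objects of $X$ exists in $\mathcal A$. Let $\partial=d_0-d_1+\cdots+(-1)^kd_k\colon C_k^\Sigma(X)\to C_{k-1}^\Sigma(X)$. Here, for $0<i<k$, the map $d_i$ composes the factors $\Sigma X(x_{i-1},x_i)\otimes\Sigma X(x_i,x_{i+1})\to\Sigma X(x_{i-1},x_{i+1})$, using composition in $X$ and monoidality of $\Sigma$, while $d_0$ and $d_k$ erase the first and the last factor respectively, using the maps $\Sigma X(x,y)\to\Sigma(1_{\mathcal V})\cong 1_{\mathcal A}$. The magnitude cochain complex is $C^k_\Sigma(X)=[C_k^\Sigma(X),1_{\mathcal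 A}]$ with differential $[\partial,1_{\mathcal A}]$, and the magnitude cohomology $H^*_\Sigma(X)$ is its cohomology. For $p,q\ge 0$ let $\Delta_{p,q}\colon C^\Sigma_{p+q}(X)\to C^\Sigma_p(X)\otimes C^\Sigma_q(X)$ be the deconcatenation map, which sends the summand at $(x_0,\dots,x_{p+q})$ by rebracketing into the tensor product of the summands at $(x_0,\dots,x_p)$ and $(x_p,\dots,x_{p+q})$. The composites $$[C_p^\Sigma(X),1_{\mathcal A}]\otimes[C_q^\Sigma(X),1_{\mathcal A}]\to[C_p^\Sigma(X)\otimes C_q^\Sigma(X),1_{\mathcal A}]\xrightarrow{[\Delta_{p,q},1_{\mathcal A}]}[C_{p+q}^\Sigma(X),1_{\mathcal A}]$$ satisfy the Leibniz rule and hence induce products $\mu_{p,q}\colon H^p_\Sigma(X)\otimes H^q_\Sigma(X)\to H^{p+q}_\Sigma(X)$. If $\mathcal V$ is cartesian (its monoidal product is the categorical product), then $H^*_\Sigma(X)$ is graded-commutative: for all $p,q\ge 0$, $$\mu_{p,q}=(-1)^{pq}\,\mu_{q,p}\circ\tau,$$ where $\tau\colon H^p_\Sigma(X)\otimes H^q_\Sigma(X)\to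 H^q_\Sigma(X)\otimes H^p_\Sigma(X)$ is the braiding of $\mathcal A$. -/

import Mathlib

open CategoryTheory MonoidalCategory Limits

universe v₁ u₁ v₂ u₂ w

noncomputable section

namespace MagnitudeCohomology

section Auxiliary

theorem aux_assoc {A : Type u₂} [Category.{v₂} A] {P Q Q' R Z : A} {e : P ⟶ Q} {f : Q ⟶ R} {e' : P ⟶ Q'} {f' : Q' ⟶ R}
    (h : e ≫ f = e' ≫ f') (g : R ⟶ Z) : e ≫ f ≫ g = e' ≫ f' ≫ g := by
  rw [← Category.assoc, h, Category.assoc]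

variable {A : Type u₂} [Category.{v₂} A] [MonoidalCategory A]

theorem aux_aug {P Q R : A} (a : P ⟶ 𝟙_ A) (f : Q ⟶ R) :
    P ◁ f ≫ a ▷ R ≫ (λ_ R).hom = (a ▷ Q ≫ (λ_ Q).hom) ≫ f := by
  simp [whisker_exchange_assoc]

theorem aux_comp_aug {P Q R T : A} (a : P ⟶ 𝟙_ A) (b : Q ⟶ 𝟙_ A) (c : R ⟶ 𝟙_ A) (m : P ⊗ Q ⟶ R)
    (h : m ≫ c = a ▷ Q ≫ (λ_ Q).hom ≫ b) :
    ((α_ P Q T).inv ≫ m ▷ T) ≫ c ▷ T ≫ (λ_ T).hom =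
      (a ▷ (Q ⊗ T) ≫ (λ_ (Q ⊗ T)).hom) ≫ b ▷ T ≫ (λ_ T).hom := by
  have := congrArg (fun f => (α_ P Q T).inv ≫ f ▷ T ≫ (λ_ T).hom) h
  simp only [comp_whiskerRight, Category.assoc] at this ⊢
  rw [this]
  monoidal

theorem aux_comp_aug' {P Q R Z : A} (a : P ⟶ 𝟙_ A) (b : Q ⟶ 𝟙_ A) (c : R ⟶ 𝟙_ A) (m : P ⊗ Q ⟶ R)
    (h : m ≫ c = a ▷ Q ≫ (λ_ Q).hom ≫ b) (g : 𝟙_ A ⟶ Z) :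
    P ◁ (b ▷ 𝟙_ A ≫ (λ_ (𝟙_ A)).hom) ≫ (a ▷ 𝟙_ A ≫ (λ_ (𝟙_ A)).hom) ≫ g =
      ((α_ P Q (𝟙_ A)).inv ≫ m ▷ 𝟙_ A) ≫ (c ▷ 𝟙_ A ≫ (λ_ (𝟙_ A)).hom) ≫ g := by
  have := aux_comp_aug (T := 𝟙_ A) a b c m h
  rw [← Category.assoc _ _ g, ← Category.assoc _ _ g, this, aux_aug]

theorem aux_comp_comp {P Q R T PQ QR PQR Z : A} (m₁ : P ⊗ Q ⟶ PQ) (m₂ : Q ⊗ R ⟶ QR)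
    (m₃ : PQ ⊗ R ⟶ PQR) (m₄ : P ⊗ QR ⟶ PQR)
    (h : (α_ P Q R).inv ≫ m₁ ▷ R ≫ m₃ = P ◁ m₂ ≫ m₄) (g : PQR ⊗ T ⟶ Z) :
    P ◁ ((α_ Q R T).inv ≫ m₂ ▷ T) ≫ ((α_ P QR T).inv ≫ m₄ ▷ T) ≫ g =
      ((α_ P Q (R ⊗ T)).inv ≫ m₁ ▷ (R ⊗ T)) ≫ ((α_ PQ R T).inv ≫ m₃ ▷ T) ≫ g := by
  have h' : (α_ P Q R).inv ▷ T ≫ m₁ ▷ R ▷ T ≫ m₃ ▷ T ≫ g = (P ◁ m₂) ▷ T ≫ m₄ ▷ T ≫ g := by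
    simp only [← comp_whiskerRight_assoc, h]
  calc _ = (P ◁ (α_ Q R T).inv ≫ (α_ P (Q ⊗ R) T).inv) ≫ (P ◁ m₂) ▷ T ≫ m₄ ▷ T ≫ g := by
        monoidal
    _ = _ := by rw [← h']; monoidal

theorem aux_comp_far {P Q R T T' Z : A} (m : P ⊗ Q ⟶ R) (f : T ⟶ T') (g : R ⊗ T' ⟶ Z) :
    P ◁ (Q ◁ f) ≫ ((α_ P Q T').inv ≫ m ▷ T') ≫ g =
      ((α_ P Q T).inv ≫ m ▷ T) ≫ R ◁ f ≫ g := by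
  simp [← whisker_exchange_assoc]

theorem aux_rebracket_first {P T T₁ T₂ : A} (a : P ⟶ 𝟙_ A) (r : T ⟶ T₁ ⊗ T₂) :
    (a ▷ T ≫ (λ_ T).hom) ≫ r =
      (P ◁ r ≫ (α_ P T₁ T₂).inv) ≫ (a ▷ T₁ ≫ (λ_ T₁).hom) ▷ T₂ := by
  rw [← aux_aug]
  monoidal

theorem aux_rebracket_second {P Q R T T₁ T₂ Z : A} (m : P ⊗ Q ⟶ R) (r : T ⟶ T₁ ⊗ T₂)
    (g : (R ⊗ T₁) ⊗ T₂ ⟶ Z) :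
    ((α_ P Q T).inv ≫ m ▷ T) ≫ (R ◁ r ≫ (α_ R T₁ T₂).inv) ≫ g =
      (P ◁ (Q ◁ r ≫ (α_ Q T₁ T₂).inv) ≫ (α_ P (Q ⊗ T₁) T₂).inv) ≫
        ((α_ P Q T₁).inv ≫ m ▷ T₁) ▷ T₂ ≫ g := by
  have := aux_comp_far m r ((α_ R T₁ T₂).inv ≫ g)
  simp only [Category.assoc] at this ⊢
  rw [← this]
  monoidal

theorem aux_rebracket_mid {P T Z : A} (a : P ⟶ 𝟙_ A) (g : 𝟙_ A ⊗ T ⟶ Z) :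
    (P ◁ (λ_ T).inv ≫ (α_ P (𝟙_ A) T).inv) ≫ (a ▷ 𝟙_ A ≫ (λ_ (𝟙_ A)).hom) ▷ T ≫ g =
      (λ_ (P ⊗ T)).inv ≫ 𝟙_ A ◁ (a ▷ T ≫ (λ_ T).hom) ≫ g := by
  monoidal

theorem aux_whiskerLeft_congr [MonoidalClosed A] {X : Type w} {P Q Q₁ Q₂ : A} {M : X → A}
    {l₁ l₂ : X} {e₁ : Q ⟶ Q₁} {e₂ : Q ⟶ Q₂} {f₁ : Q₁ ⟶ M l₁} {f₂ : Q₂ ⟶ M l₂}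
    (h : ∀ {Z : A} (g : ∀ l, M l ⟶ Z), e₁ ≫ f₁ ≫ g l₁ = e₂ ≫ f₂ ≫ g l₂) {Z : A}
    (g : ∀ l, P ⊗ M l ⟶ Z) : P ◁ e₁ ≫ P ◁ f₁ ≫ g l₁ = P ◁ e₂ ≫ P ◁ f₂ ≫ g l₂ := by
  apply MonoidalClosed.curry_injective
  simp only [MonoidalClosed.curry_natural_left]
  exact h fun l => MonoidalClosed.curry (g l)

variable [MonoidalClosed A] {X : Type w} {M N : X → A} {a b : X}

theorem aux_whiskerLeft_congr₂ {P Q Q₁ Q₂ : A}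
    {e₁ : Q ⟶ Q₁} {e₂ : Q ⟶ Q₂} {f₁ : Q₁ ⟶ M a ⊗ N a} {f₂ : Q₂ ⟶ M b ⊗ N b}
    (h : ∀ {Z : A} (g : ∀ l, M l ⊗ N l ⟶ Z), e₁ ≫ f₁ ≫ g a = e₂ ≫ f₂ ≫ g b) {Z : A}
    (g : ∀ l, (P ⊗ M l) ⊗ N l ⟶ Z) :
    P ◁ e₁ ≫ (P ◁ f₁ ≫ (α_ P (M a) (N a)).inv) ≫ g a =
      P ◁ e₂ ≫ (P ◁ f₂ ≫ (α_ P (M b) (N b)).inv) ≫ g b := by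
  have := aux_whiskerLeft_congr (P := P) (M := fun l => M l ⊗ N l) h
    fun l => (α_ P (M l) (N l)).inv ≫ g l
  simpa using this

theorem aux_rebracket_left {P Q Q₁ Q₂ : A}
    {e₁ : Q ⟶ Q₁} {e₂ : Q ⟶ Q₂ ⊗ N b} {f₁ : Q₁ ⟶ M a ⊗ N a} {f₂ : Q₂ ⟶ M b}
    (h : ∀ {Z : A} (g : ∀ l, M l ⊗ N l ⟶ Z), e₁ ≫ f₁ ≫ g a = e₂ ≫ f₂ ▷ N b ≫ g b) {Z : A}
    (g : ∀ l, (P ⊗ M l) ⊗ N l ⟶ Z) :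
    P ◁ e₁ ≫ (P ◁ f₁ ≫ (α_ P (M a) (N a)).inv) ≫ g a =
      (P ◁ e₂ ≫ (α_ P Q₂ (N b)).inv) ≫ (P ◁ f₂) ▷ N b ≫ g b := by
  rw [aux_whiskerLeft_congr₂ h g]
  monoidal

theorem aux_rebracket_right {P Q Q₁ Q₂ : A}
    {e₁ : Q ⟶ Q₁} {e₂ : Q ⟶ M b ⊗ Q₂} {f₁ : Q₁ ⟶ M a ⊗ N a} {f₂ : Q₂ ⟶ N b}
    (h : ∀ {Z : A} (g : ∀ l, M l ⊗ N l ⟶ Z), e₁ ≫ f₁ ≫ g a = e₂ ≫ M b ◁ f₂ ≫ g b) {Z : A}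
    (g : ∀ l, (P ⊗ M l) ⊗ N l ⟶ Z) :
    P ◁ e₁ ≫ (P ◁ f₁ ≫ (α_ P (M a) (N a)).inv) ≫ g a =
      (P ◁ e₂ ≫ (α_ P (M b) Q₂).inv) ≫ (P ⊗ M b) ◁ f₂ ≫ g b := by
  rw [aux_whiskerLeft_congr₂ h g]
  monoidal

theorem aux_rebracket_both {P Q Q₁ Q₂ : A}
    {e₁ : Q ⟶ Q₁ ⊗ N a} {e₂ : Q ⟶ M b ⊗ Q₂} {f₁ : Q₁ ⟶ M a} {f₂ : Q₂ ⟶ N b}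
    (h : ∀ {Z : A} (g : ∀ l, M l ⊗ N l ⟶ Z), e₁ ≫ f₁ ▷ N a ≫ g a = e₂ ≫ M b ◁ f₂ ≫ g b) {Z : A}
    (g : ∀ l, (P ⊗ M l) ⊗ N l ⟶ Z) :
    (P ◁ e₁ ≫ (α_ P Q₁ (N a)).inv) ≫ (P ◁ f₁) ▷ N a ≫ g a =
      (P ◁ e₂ ≫ (α_ P (M b) Q₂).inv) ≫ (P ⊗ M b) ◁ f₂ ≫ g b := by
  have := aux_whiskerLeft_congr₂ h g
  calc _ = P ◁ e₁ ≫ (P ◁ f₁ ▷ N a ≫ (α_ P (M a) (N a)).inv) ≫ g a := by monoidal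
    _ = _ := by rw [this]; monoidal

end Auxiliary

section Paths

variable {V : Type u₁} [Category.{v₁} V] [SemiCartesianMonoidalCategory V]
variable {A : Type u₂} [Category.{v₂} A] [MonoidalCategory A]
variable (S : V ⥤ A)
variable {X : Type w} [EnrichedCategory V X]

/-- The object `Σ X(x, y)` of `A`. -/
abbrev homObj (x y : X) : A := S.obj (EnrichedCategory.Hom x y : V)

/-- For a nonempty sequence `x₀, x₁, …, x_k`, written as a first entry `x₀` and the list
`[x₁, …, x_k]`, the object `Σ X(x₀, x₁) ⊗ (Σ X(x₁, x₂) ⊗ (⋯ ⊗ (Σ X(x_{k-1}, x_k) ⊗ 1)))`. -/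
def pathObj : X → List X → A
  | _, [] => 𝟙_ A
  | x, y :: l => homObj S x y ⊗ pathObj y l

/-- The entry `x_p` of the sequence `x₀, …, x_k`, where `l = [x₁, …, x_k]` and `p ≤ k`. -/
def entry : ℕ → X → List X → X
  | 0, x, _ => x
  | _ + 1, x, [] => x
  | p + 1, _, y :: l => entry p y l

/-- The rebracketing map
`Σ X(x₀, x₁) ⊗ ⋯ ⊗ Σ X(x_{k-1}, x_k) ⟶`
`(Σ X(x₀, x₁) ⊗ ⋯ ⊗ Σ X(x_{p-1}, x_p)) ⊗ (Σ X(x_p, x_{p+1}) ⊗ ⋯ ⊗ Σ X(x_{k-1}, x_k))`. -/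
def rebracket : (p : ℕ) → (x : X) → (l : List X) →
    (pathObj S x l ⟶ pathObj S x (l.take p) ⊗ pathObj S (entry p x l) (l.drop p))
  | 0, x, l => (λ_ (pathObj S x l)).inv
  | _ + 1, x, [] => (λ_ (pathObj S x [])).inv
  | p + 1, x, y :: l => homObj S x y ◁ rebracket p y l ≫ (α_ _ _ _).inv

variable [S.Monoidal]

/-- Composition `Σ X(x, y) ⊗ Σ X(y, z) ⟶ Σ X(x, z)`, from monoidality of `Σ` and composition
in `X`. -/
def homComp (x y z : X) : homObj S x y ⊗ homObj S y z ⟶ homObj S x z :=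
  Functor.LaxMonoidal.μ S _ _ ≫ S.map (eComp V x y z)

/-- The map `Σ X(x, y) ⟶ Σ 1 ≅ 1`, from terminality of the unit of `V` and monoidality
of `Σ`. -/
def homAug (x y : X) : homObj S x y ⟶ 𝟙_ A :=
  S.map (SemiCartesianMonoidalCategory.toUnit _) ≫ Functor.OplaxMonoidal.η S

/-- Erasing the first entry `x₀` of `x₀, x₁, …, x_k`, where `l = [x₁, …, x_k]`: the first tensor
factor is erased. (If there is no entry `x₁`, this is the identity.) -/
def firstFace : (x : X) → (l : List X) → (pathObj S x l ⟶ pathObj S (entry 1 x l) l.tail)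
  | _, [] => 𝟙 _
  | x, y :: l => homAug S x y ▷ pathObj S y l ≫ (λ_ _).hom

/-- Erasing the entry `x₁` of `x₀, x₁, …, x_k`, where `l = [x₁, …, x_k]`. If `k > 1`, then the
first two factors are composed; if `k = 1`, then the only factor is erased. -/
def secondFace : (x : X) → (l : List X) → (pathObj S x l ⟶ pathObj S x (l.eraseIdx 0))
  | _, [] => 𝟙 _
  | x, [y] => homAug S x y ▷ 𝟙_ A ≫ (λ_ _).hom
  | x, y :: z :: l => (α_ _ _ _).inv ≫ homComp S x y z ▷ pathObj S z l

/-- Erasing the entry `x_{i+1}` of `x₀, x₁, …, x_k`, where `l = [x₁, …, x_k]`. If it is not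
the last entry, then the two factors adjacent to it are composed; if it is the last one,
then the last factor is erased. (If there is no entry `x_{i+1}`, this is the identity.) -/
def laterFace : (i : ℕ) → (x : X) → (l : List X) → (pathObj S x l ⟶ pathObj S x (l.eraseIdx i))
  | 0, x, l => secondFace S x l
  | _ + 1, _, [] => 𝟙 _
  | i + 1, x, y :: l => homObj S x y ◁ laterFace i y l

theorem homComp_homAug (x y z : X) :
    homComp S x y z ≫ homAug S x z = homAug S x y ▷ _ ≫ (λ_ _).hom ≫ homAug S y z := by
  have h : eComp V x y z ≫ SemiCartesianMonoidalCategory.toUnit _ =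
      SemiCartesianMonoidalCategory.toUnit _ ▷ _ ≫ (λ_ _).hom ≫
        SemiCartesianMonoidalCategory.toUnit _ := Subsingleton.elim _ _
  simp only [homComp, homAug, Category.assoc, ← S.map_comp_assoc]
  rw [h]
  simp only [S.map_comp, comp_whiskerRight, Category.assoc, Functor.Monoidal.map_leftUnitor,
    Functor.Monoidal.map_whiskerRight]
  simp

theorem homComp_assoc (x y z t : X) :
    (α_ _ _ _).inv ≫ homComp S x y z ▷ homObj S z t ≫ homComp S x z t =
      homObj S x y ◁ homComp S y z t ≫ homComp S x y t :=
  EnrichedCategory.assoc (V := A) (C := TransportEnrichment S X) x y z t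

theorem secondFace_firstFace (x : X) (l : List X) (hl : 1 < l.length) {Z : A}
    (g : ∀ m : X × List X, pathObj S m.1 m.2 ⟶ Z) :
    laterFace S 0 x l ≫ firstFace S x (l.eraseIdx 0) ≫
        g (entry 1 x (l.eraseIdx 0), (l.eraseIdx 0).tail) =
      firstFace S x l ≫ firstFace S (entry 1 x l) l.tail ≫
        g (entry 1 (entry 1 x l) l.tail, l.tail.tail) := by
  match l, hl with
  | y :: z :: l, _ =>
    exact aux_assoc (aux_comp_aug (T := pathObj S z l) _ _ _ _ (homComp_homAug S x y z)) (g (z, l))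

theorem laterFace_firstFace (j : ℕ) (x : X) (l : List X) (hl : 0 < l.length) {Z : A}
    (g : ∀ m : X × List X, pathObj S m.1 m.2 ⟶ Z) :
    laterFace S (j + 1) x l ≫ firstFace S x (l.eraseIdx (j + 1)) ≫
        g (entry 1 x (l.eraseIdx (j + 1)), (l.eraseIdx (j + 1)).tail) =
      firstFace S x l ≫ laterFace S j (entry 1 x l) l.tail ≫
        g (entry 1 x l, l.tail.eraseIdx j) := by
  match l, hl with
  | y :: l, _ =>
    exact aux_assoc (aux_aug (homAug S x y) (laterFace S j y l)) (g (y, l.eraseIdx j))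

/-- Erasing the first entry, for a nonempty first part. -/
theorem firstFace_rebracket (p : ℕ) (x : X) (l : List X) (hl : 0 < l.length) {Z : A}
    (g : ∀ m : (X × List X) × X × List X, pathObj S m.1.1 m.1.2 ⊗ pathObj S m.2.1 m.2.2 ⟶ Z) :
    firstFace S x l ≫ rebracket S p (entry 1 x l) l.tail ≫ g ((_, _), _, _) =
      rebracket S (p + 1) x l ≫ firstFace S x (l.take (p + 1)) ▷ _ ≫
        g ((entry 1 x (l.take (p + 1)), (l.take (p + 1)).tail), _, _) := by
  match l, hl with
  | y :: l, _ =>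
    exact aux_assoc (aux_rebracket_first (homAug S x y) (rebracket S p y l))
      (g ((y, l.take p), entry p y l, l.drop p))

variable [MonoidalClosed A]

theorem laterFace_laterFace (i j : ℕ) (hij : i ≤ j) (x : X) (l : List X)
    (hl : j + 1 < l.length) {Z : A} (g : ∀ m : List X, pathObj S x m ⟶ Z) :
    laterFace S (j + 1) x l ≫ laterFace S i x (l.eraseIdx (j + 1)) ≫ g _ =
      laterFace S i x l ≫ laterFace S j x (l.eraseIdx i) ≫ g _ := by
  induction i generalizing j x l Z with
  | zero =>
    match j, l, hl with
    | 0, [y, z], _ => exact aux_comp_aug' _ _ _ _ (homComp_homAug S x y z) (g [])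
    | 0, y :: z :: t :: l, _ =>
      exact aux_comp_comp _ _ _ _ (homComp_assoc S x y z t) (g (t :: l))
    | j + 1, y :: z :: l, _ =>
      exact aux_comp_far (homComp S x y z) (laterFace S j z l) (g (z :: l.eraseIdx j))
  | succ i ih =>
    match j, l, hl with
    | j + 1, y :: l, hl =>
      exact aux_whiskerLeft_congr (P := homObj S x y) (M := fun m => pathObj S y m)
        (fun g => ih j (by omega) y l (by simpa using hl) g) (fun m => g (y :: m))

/-- Erasing an entry before the cut. -/
theorem laterFace_rebracket_left (i p : ℕ) (hip : i < p) (x : X) (l : List X)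
    (hl : p < l.length) {Z : A}
    (g : ∀ m : List X × X × List X, pathObj S x m.1 ⊗ pathObj S m.2.1 m.2.2 ⟶ Z) :
    laterFace S i x l ≫ rebracket S p x (l.eraseIdx i) ≫ g (_, _, _) =
      rebracket S (p + 1) x l ≫ laterFace S i x (l.take (p + 1)) ▷ _ ≫ g (_, _, _) := by
  induction i generalizing p x l Z with
  | zero =>
    match p, l, hl with
    | p + 1, y :: z :: l, _ =>
      exact aux_rebracket_second (homComp S x y z) (rebracket S p z l) (g (z :: l.take p, _, _))
  | succ i ih =>
    match p, l, hl with
    | p + 1, y :: l, hl =>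
      exact aux_rebracket_left (P := homObj S x y) (M := fun m : List X × X × List X => pathObj S y m.1)
        (N := fun m : List X × X × List X => pathObj S m.2.1 m.2.2)
        (a := ((l.eraseIdx i).take p, entry p y (l.eraseIdx i), (l.eraseIdx i).drop p)) (b := ((l.take (p + 1)).eraseIdx i, entry (p + 1) y l, l.drop (p + 1)))
        (fun g => ih p (by omega) y l (by simpa using hl) g) (fun m : List X × X × List X => g (y :: m.1, m.2))

/-- Erasing an entry after the cut. -/
theorem laterFace_rebracket_right (j p : ℕ) (x : X) (l : List X)
    (hl : j + p < l.length) {Z : A}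
    (g : ∀ m : List X × X × List X, pathObj S x m.1 ⊗ pathObj S m.2.1 m.2.2 ⟶ Z) :
    laterFace S (j + p) x l ≫ rebracket S p x (l.eraseIdx (j + p)) ≫ g (_, _, _) =
      rebracket S p x l ≫ _ ◁ laterFace S j (entry p x l) (l.drop p) ≫ g (_, _, _) := by
  induction p generalizing x l Z with
  | zero =>
    exact (leftUnitor_inv_naturality_assoc (laterFace S j x l) (g ([], x, l.eraseIdx j)))
  | succ p ih =>
    match l, hl with
    | y :: l, hl =>
      exact aux_rebracket_right (P := homObj S x y) (M := fun m : List X × X × List X => pathObj S y m.1)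
        (N := fun m : List X × X × List X => pathObj S m.2.1 m.2.2)
        (a := ((l.eraseIdx (j + p)).take p, entry p y (l.eraseIdx (j + p)), (l.eraseIdx (j + p)).drop p)) (b := (l.take p, entry p y l, (l.drop p).eraseIdx j))
        (fun g => ih y l (by simp at hl; omega) g) (fun m : List X × X × List X => g (y :: m.1, m.2))

/-- Erasing the end of the first part, or the start of the second part. -/
theorem rebracket_middle (p : ℕ) (x : X) (l : List X)
    (hl : p < l.length) {Z : A}
    (g : ∀ m : List X × X × List X, pathObj S x m.1 ⊗ pathObj S m.2.1 m.2.2 ⟶ Z) :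
    rebracket S (p + 1) x l ≫ laterFace S p x (l.take (p + 1)) ▷ _ ≫ g (_, _, _) =
      rebracket S p x l ≫ _ ◁ firstFace S (entry p x l) (l.drop p) ≫
        g (l.take p, entry 1 (entry p x l) (l.drop p), (l.drop p).tail) := by
  induction p generalizing x l Z with
  | zero =>
    match l, hl with
    | y :: l, hl => exact aux_rebracket_mid (homAug S x y) (g ([], y, l))
  | succ p ih =>
    match l, hl with
    | y :: l, hl =>
      exact aux_rebracket_both (P := homObj S x y) (M := fun m : List X × X × List X => pathObj S y m.1)
        (N := fun m : List X × X × List X => pathObj S m.2.1 m.2.2)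
        (a := ((l.take (p + 1)).eraseIdx p, entry (p + 1) y l, l.drop (p + 1))) (b := (l.take p, entry 1 (entry p y l) (l.drop p), (l.drop p).tail))
        (fun g => ih y l (by simp at hl; omega) g) (fun m : List X × X × List X => g (y :: m.1, m.2))

end Paths

section Nerve

variable {V : Type u₁} [Category.{v₁} V] [SemiCartesianMonoidalCategory V]
variable {A : Type u₂} [Category.{v₂} A] [MonoidalCategory A]
variable (S : V ⥤ A)
variable (X : Type w) [EnrichedCategory V X]

/-- Sequences `x₀, …, x_k` of elements of `X`, as a first entry and a list of length `k`. -/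
abbrev Simplex (X : Type w) (k : ℕ) : Type w := {s : X × List X // s.2.length = k}

/-- The summand `Σ X(x₀, x₁) ⊗ ⋯ ⊗ Σ X(x_{k-1}, x_k)` at a sequence `x₀, …, x_k`. -/
abbrev summand (k : ℕ) (s : Simplex X k) : A := pathObj S s.1.1 s.1.2

variable [∀ k, HasCoproduct (summand S X k)]

/-- The magnitude nerve in degree `k`, `⨁_{x₀, …, x_k} Σ X(x₀, x₁) ⊗ ⋯ ⊗ Σ X(x_{k-1}, x_k)`. -/
def nerve (k : ℕ) : A := ∐ summand S X k

variable {X}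

/-- The inclusion of the summand at the sequence `x` followed by the list `l`. -/
def incl (k : ℕ) (x : X) (l : List X) (h : l.length = k) : pathObj S x l ⟶ nerve S X k :=
  Sigma.ι (summand S X k) ⟨(x, l), h⟩

variable {S}

/-- The map out of the nerve with prescribed components. -/
def nerveDesc {k : ℕ} {Z : A} (f : ∀ (x : X) (l : List X), l.length = k → (pathObj S x l ⟶ Z)) :
    nerve S X k ⟶ Z :=
  Sigma.desc fun s => f s.1.1 s.1.2 s.2

theorem incl_desc {k : ℕ} {Z : A}
    (f : ∀ (x : X) (l : List X), l.length = k → (pathObj S x l ⟶ Z)) (x : X) (l : List X)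
    (h : l.length = k) : incl S k x l h ≫ nerveDesc f = f x l h := by
  exact Sigma.ι_desc _ _

theorem nerve_hom_ext {k : ℕ} {Z : A} {f g : nerve S X k ⟶ Z}
    (h : ∀ (x : X) (l : List X) (hl : l.length = k), incl S k x l hl ≫ f = incl S k x l hl ≫ g) :
    f = g :=
  Sigma.hom_ext _ _ fun s => h s.1.1 s.1.2 s.2

variable (S X)

/-- The component `Δ : B_n ⟶ B_p ⊗ B_q` of the coproduct, for `p + q = n`: it sends the summand
at `x₀, …, x_n` into the tensor product of the summands at `x₀, …, x_p` and `x_p, …, x_n`. -/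
def coproduct (p q n : ℕ) (h : p + q = n) : nerve S X n ⟶ nerve S X p ⊗ nerve S X q :=
  nerveDesc fun x l hl => rebracket S p x l ≫
    (incl S p x (l.take p) (by simp; omega) ⊗ₘ
      incl S q (entry p x l) (l.drop p) (by simp; omega))

variable {X}

theorem incl_coproduct (p q n : ℕ) (h : p + q = n) (x : X) (l : List X) (hl : l.length = n) :
    incl S n x l hl ≫ coproduct S X p q n h = rebracket S p x l ≫
      (incl S p x (l.take p) (by simp; omega) ⊗ₘ
        incl S q (entry p x l) (l.drop p) (by simp; omega)) :=
  incl_desc _ _ _ _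

section Total

variable [Preadditive A]

/-- The inclusion of a summand, extended by zero. -/
def inclTotal (k : ℕ) (m : X × List X) : pathObj S m.1 m.2 ⟶ nerve S X k :=
  if h : m.2.length = k then incl S k m.1 m.2 h else 0

theorem inclTotal_eq (k : ℕ) (x : X) (l : List X) (hl : l.length = k) :
    inclTotal S k (x, l) = incl S k x l hl :=
  dif_pos hl

/-- The inclusion of a summand of `B_p ⊗ B_q`, extended by zero. -/
def inclTensor (p q : ℕ) (m : (X × List X) × X × List X) :
    pathObj S m.1.1 m.1.2 ⊗ pathObj S m.2.1 m.2.2 ⟶ nerve S X p ⊗ nerve S X q :=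
  inclTotal S p m.1 ⊗ₘ inclTotal S q m.2

theorem inclTensor_eq (p q : ℕ) (x y : X) (l m : List X) (hl : l.length = p) (hm : m.length = q) :
    inclTensor S p q ((x, l), y, m) = incl S p x l hl ⊗ₘ incl S q y m hm := by
  rw [inclTensor, inclTotal_eq S p x l hl, inclTotal_eq S q y m hm]

end Total

end Nerve

section Complex

variable {V : Type u₁} [Category.{v₁} V] [SemiCartesianMonoidalCategory V]
variable {A : Type u₂} [Category.{v₂} A] [MonoidalCategory A]
variable (S : V ⥤ A) [S.Monoidal]
variable (X : Type w) [EnrichedCategory V X] [∀ k, HasCoproduct (summand S X k)]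

/-- The outer face map `d₀ : B_{k+1} ⟶ B_k` of the magnitude nerve. -/
def nerveFirstFace (k : ℕ) : nerve S X (k + 1) ⟶ nerve S X k :=
  nerveDesc fun x l h => firstFace S x l ≫ incl S k (entry 1 x l) l.tail (by simp [h])

/-- The face map `d_{i+1} : B_{k+1} ⟶ B_k` of the magnitude nerve. -/
def nerveLaterFace (k : ℕ) (i : Fin (k + 1)) : nerve S X (k + 1) ⟶ nerve S X k :=
  nerveDesc fun x l h => laterFace S i x l ≫
    incl S k x (l.eraseIdx i) (by rw [List.length_eraseIdx_of_lt (by omega)]; omega)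

/-- The face maps `d₀, …, d_{k+1} : B_{k+1} ⟶ B_k` of the magnitude nerve. -/
def nerveFace (k : ℕ) (i : Fin (k + 2)) : nerve S X (k + 1) ⟶ nerve S X k :=
  Fin.cases (nerveFirstFace S X k) (nerveLaterFace S X k) i

/-- The boundary `∂ = d₀ - d₁ + ⋯`. -/
def boundary [Preadditive A] (k : ℕ) : nerve S X (k + 1) ⟶ nerve S X k :=
  ∑ i : Fin (k + 2), (-1 : ℤ) ^ (i : ℕ) • nerveFace S X k i

variable {X}

theorem incl_nerveFace_zero (k : ℕ) (x : X) (l : List X) (h : l.length = k + 1) :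
    incl S (k + 1) x l h ≫ nerveFace S X k 0 =
      firstFace S x l ≫ incl S k (entry 1 x l) l.tail (by simp [h]) := by
  rw [show nerveFace S X k 0 = nerveFirstFace S X k from rfl, nerveFirstFace, incl_desc]

theorem incl_nerveFace_succ (k : ℕ) (i : Fin (k + 1)) (x : X) (l : List X)
    (h : l.length = k + 1) :
    incl S (k + 1) x l h ≫ nerveFace S X k i.succ = laterFace S i x l ≫
      incl S k x (l.eraseIdx i) (by rw [List.length_eraseIdx_of_lt (by omega)]; omega) := by
  rw [show nerveFace S X k i.succ = nerveLaterFace S X k i from rfl, nerveLaterFace, incl_desc]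

variable (X) [Preadditive A] [MonoidalClosed A]

theorem nerveFace_nerveFace (k : ℕ) (i j : Fin (k + 2)) (hij : i ≤ j) :
    nerveFace S X (k + 1) j.succ ≫ nerveFace S X k i =
      nerveFace S X (k + 1) i.castSucc ≫ nerveFace S X k j := by
  apply nerve_hom_ext
  intro x l hl
  induction i using Fin.cases with
  | zero =>
    rw [reassoc_of% @incl_nerveFace_succ, incl_nerveFace_zero, Fin.castSucc_zero,
      reassoc_of% @incl_nerveFace_zero]
    induction j using Fin.cases with
    | zero =>
      have h := secondFace_firstFace S x l (by omega) (inclTotal S k)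
      rw [inclTotal_eq S k _ _ ?_, inclTotal_eq S k _ _ ?_] at h
      · rw [incl_nerveFace_zero]
        exact h
    | succ j =>
      have h := laterFace_firstFace S j x l (by omega) (inclTotal S k)
      rw [inclTotal_eq S k _ _ ?_, inclTotal_eq S k _ _ ?_] at h
      · rw [incl_nerveFace_succ]
        exact h
  | succ i =>
    induction j using Fin.cases with
    | zero => simp at hij
    | succ j =>
      have h := laterFace_laterFace S i j (by simpa using hij) x l (by omega)
        (fun m => inclTotal S k (x, m))
      rw [inclTotal_eq S k _ _ ?_, inclTotal_eq S k _ _ ?_] at h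
      · rw [reassoc_of% @incl_nerveFace_succ, incl_nerveFace_succ, ← Fin.succ_castSucc,
          reassoc_of% @incl_nerveFace_succ, incl_nerveFace_succ]
        exact h

theorem boundary_boundary (k : ℕ) : boundary S X (k + 1) ≫ boundary S X k = 0 := by
  simp only [boundary, Preadditive.comp_sum, Preadditive.sum_comp, ← Finset.sum_product']
  let P := Fin (k + 2) × Fin (k + 3)
  let T : Finset P := {ij : P | (ij.2 : ℕ) ≤ (ij.1 : ℕ)}
  rw [Finset.univ_product_univ, ← Finset.sum_add_sum_compl T, ← eq_neg_iff_add_eq_zero,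
    ← Finset.sum_neg_distrib]
  let φ : ∀ ij : P, ij ∈ T → P := fun ij hij =>
    (Fin.castLT ij.2 (lt_of_le_of_lt (Finset.mem_filter.mp hij).right (Fin.is_lt ij.1)), ij.1.succ)
  apply Finset.sum_bij φ
  · intro ij hij
    simp_rw [T, φ, Finset.compl_filter, Finset.mem_filter_univ, Fin.val_succ,
      Fin.val_castLT] at hij ⊢
    lia
  · rintro ⟨i, j⟩ hij ⟨i', j'⟩ hij' h
    rw [Prod.mk_inj]
    exact ⟨by simpa [φ] using! congr_arg Prod.snd h,
      by simpa [φ, Fin.castSucc_castLT] using! congr_arg Fin.castSucc (congr_arg Prod.fst h)⟩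
  · rintro ⟨i', j'⟩ hij'
    simp_rw [T, Finset.compl_filter, Finset.mem_filter_univ, not_le] at hij'
    refine ⟨(j'.pred <| ?_, Fin.castSucc i'), ?_, ?_⟩
    · rintro rfl
      simp only [Fin.val_zero, not_lt_zero] at hij'
    · simpa [T] using! Nat.le_sub_one_of_lt hij'
    · simp only [φ, Fin.castLT_castSucc, Fin.succ_pred]
  · rintro ⟨i, j⟩ hij
    dsimp
    simp only [Preadditive.zsmul_comp, Preadditive.comp_zsmul, smul_smul, ← neg_smul]
    congr 1
    · simp only [φ, Fin.val_succ, pow_add, pow_one, mul_neg, neg_neg, mul_one]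
      apply mul_comm
    · have hji : (j : ℕ) ≤ i := by simpa [T] using! hij
      have h := nerveFace_nerveFace S X k (Fin.castLT j (by omega)) i (by simpa [Fin.le_def] using hji)
      rw [h, Fin.castSucc_castLT]

theorem nerveFace_coproduct_left (p q n : ℕ) (h : p + q = n) (i : Fin (p + 1)) :
    nerveFace S X n (i.castLE (by omega)) ≫ coproduct S X p q n h =
      coproduct S X (p + 1) q (n + 1) (by omega) ≫ nerveFace S X p i.castSucc ▷ nerve S X q := by
  apply nerve_hom_ext
  intro x l hl
  rw [reassoc_of% @incl_coproduct, tensorHom_comp_whiskerRight]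
  induction i using Fin.cases with
  | zero =>
    have h' := firstFace_rebracket S p x l (by omega) (inclTensor S p q)
    rw [inclTensor_eq S p q _ _ _ _ ?_ ?_, inclTensor_eq S p q _ _ _ _ ?_ ?_,
      whiskerRight_comp_tensorHom] at h'
    · have e : ∀ hp : p + 1 ≤ n + 2, Fin.castLE hp (0 : Fin (p + 1)) = 0 := fun _ => rfl
      rw [e, reassoc_of% @incl_nerveFace_zero,
        Fin.castSucc_zero, incl_nerveFace_zero, incl_coproduct]
      exact h'
  | succ i =>
    have h' := laterFace_rebracket_left S i p (by omega) x l (by omega)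
      (fun m => inclTensor S p q ((x, m.1), m.2))
    rw [inclTensor_eq S p q _ _ _ _ ?_ ?_, inclTensor_eq S p q _ _ _ _ ?_ ?_,
      whiskerRight_comp_tensorHom] at h'
    · have e : ∀ hp : p + 1 ≤ n + 2, Fin.castLE hp i.succ =
          (i.castLE (by omega) : Fin (n + 1)).succ := fun _ => rfl
      rw [e,
        reassoc_of% @incl_nerveFace_succ, ← Fin.succ_castSucc, incl_nerveFace_succ, incl_coproduct]
      exact h'

theorem nerveFace_coproduct_right (p q n : ℕ) (h : p + q = n) (j : Fin (q + 1)) :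
    nerveFace S X n ⟨j + p + 1, by omega⟩ ≫ coproduct S X p q n h =
      coproduct S X p (q + 1) (n + 1) (by omega) ≫ nerve S X p ◁ nerveFace S X q j.succ := by
  apply nerve_hom_ext
  intro x l hl
  rw [reassoc_of% @incl_coproduct, tensorHom_comp_whiskerLeft]
  have h' := laterFace_rebracket_right S j p x l (by omega)
    (fun m => inclTensor S p q ((x, m.1), m.2))
  rw [inclTensor_eq S p q _ _ _ _ ?_ ?_, inclTensor_eq S p q _ _ _ _ ?_ ?_,
    whiskerLeft_comp_tensorHom] at h'
  · rw [show (⟨j + p + 1, _⟩ : Fin (n + 2)) = Fin.succ ⟨j + p, by omega⟩ from rfl,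
      reassoc_of% @incl_nerveFace_succ, incl_nerveFace_succ, incl_coproduct]
    exact h'

theorem coproduct_nerveFace_middle (p q n : ℕ) (h : p + q = n) :
    coproduct S X (p + 1) q (n + 1) (by omega) ≫ nerveFace S X p (Fin.last _) ▷ nerve S X q =
      coproduct S X p (q + 1) (n + 1) (by omega) ≫ nerve S X p ◁ nerveFace S X q 0 := by
  apply nerve_hom_ext
  intro x l hl
  rw [reassoc_of% @incl_coproduct, reassoc_of% @incl_coproduct, tensorHom_comp_whiskerLeft,
    tensorHom_comp_whiskerRight]
  have h' := rebracket_middle S p x l (by omega)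
    (fun m => inclTensor S p q ((x, m.1), m.2))
  rw [inclTensor_eq S p q _ _ _ _ ?_ ?_, inclTensor_eq S p q _ _ _ _ ?_ ?_,
    whiskerLeft_comp_tensorHom, whiskerRight_comp_tensorHom] at h'
  · rw [← Fin.succ_last, incl_nerveFace_succ, incl_nerveFace_zero]
    exact h'

theorem sum_fin_split {M : Type v₂} [AddCommMonoid M] (p q n : ℕ) (h : p + q = n)
    (f : Fin (n + 2) → M) :
    ∑ i, f i = ∑ i : Fin (p + 1), f (i.castLE (by omega)) +
      ∑ j : Fin (q + 1), f ⟨j + p + 1, by omega⟩ := by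
  rw [← (finCongr (show (p + 1) + (q + 1) = n + 2 by omega)).sum_comp, Fin.sum_univ_add]
  congr 1
  refine Finset.sum_congr rfl fun j _ => congrArg f (Fin.ext ?_)
  simp
  omega

theorem coproduct_boundary [MonoidalPreadditive A] (p q n : ℕ) (h : p + q = n) :
    boundary S X n ≫ coproduct S X p q n h =
      coproduct S X (p + 1) q (n + 1) (by omega) ≫ boundary S X p ▷ nerve S X q +
      (-1 : ℤ) ^ p •
        coproduct S X p (q + 1) (n + 1) (by omega) ≫ nerve S X p ◁ boundary S X q := by
  have h₁ : coproduct S X (p + 1) q (n + 1) (by omega) ≫ boundary S X p ▷ nerve S X q =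
      ∑ i : Fin (p + 2), (-1 : ℤ) ^ (i : ℕ) •
        coproduct S X (p + 1) q (n + 1) (by omega) ≫ nerveFace S X p i ▷ nerve S X q := by
    change _ ≫ (tensorRight (nerve S X q)).map (boundary S X p) = _
    simp only [boundary, Functor.map_sum, Functor.map_zsmul, Preadditive.comp_sum,
      Preadditive.comp_zsmul]
    rfl
  have h₂ : coproduct S X p (q + 1) (n + 1) (by omega) ≫ nerve S X p ◁ boundary S X q =
      ∑ i : Fin (q + 2), (-1 : ℤ) ^ (i : ℕ) •
        coproduct S X p (q + 1) (n + 1) (by omega) ≫ nerve S X p ◁ nerveFace S X q i := by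
    change _ ≫ (tensorLeft (nerve S X p)).map (boundary S X q) = _
    simp only [boundary, Functor.map_sum, Functor.map_zsmul, Preadditive.comp_sum,
      Preadditive.comp_zsmul]
    rfl
  rw [h₁, h₂, Fin.sum_univ_castSucc (n := p + 1), Fin.sum_univ_succ (n := q + 1)]
  simp only [boundary, Preadditive.sum_comp, Preadditive.zsmul_comp]
  rw [sum_fin_split p q n h]
  simp only [nerveFace_coproduct_left, nerveFace_coproduct_right]
  rw [smul_add, Finset.smul_sum, coproduct_nerveFace_middle S X p q n h]
  refine Eq.trans ?_ (add_assoc _ _ _).symm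
  congr 1
  refine Eq.trans ?_ (add_assoc _ _ _)
  rw [smul_smul]
  have e : ∀ Y : nerve S X (n + 1) ⟶ nerve S X p ⊗ nerve S X q,
      (-1 : ℤ) ^ ((Fin.last (p + 1) : Fin (p + 2)) : ℕ) • Y +
        ((-1 : ℤ) ^ p * (-1 : ℤ) ^ ((0 : Fin (q + 2)) : ℕ)) • Y = 0 := by
    intro Y
    rw [← add_smul]
    simp [pow_succ]
  rw [e, zero_add]
  refine Finset.sum_congr rfl fun j _ => ?_
  rw [smul_smul, ← pow_add]
  congr 2
  simp
  omega

end Complex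

section DualProduct

variable {A : Type u₂} [Category.{v₂} A] [MonoidalCategory A] [SymmetricCategory A]
  [MonoidalClosed A]

/-- The evaluation `(P ⊗ Q) ⊗ ([P, 1] ⊗ [Q, 1]) ≅ (P ⊗ [P, 1]) ⊗ (Q ⊗ [Q, 1]) ⟶ 1 ⊗ 1 ≅ 1`. -/
def dualPairing (P Q : A) :
    (P ⊗ Q) ⊗ ((ihom P).obj (𝟙_ A) ⊗ (ihom Q).obj (𝟙_ A)) ⟶ 𝟙_ A :=
  tensorμ P Q ((ihom P).obj (𝟙_ A)) ((ihom Q).obj (𝟙_ A)) ≫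
    ((ihom.ev P).app (𝟙_ A) ⊗ₘ (ihom.ev Q).app (𝟙_ A)) ≫ (λ_ (𝟙_ A)).hom

/-- The map `[P, 1] ⊗ [Q, 1] ⟶ [R, 1]` dual to `Δ : R ⟶ P ⊗ Q`: it is the composite
`[P, 1] ⊗ [Q, 1] ⟶ [P ⊗ Q, 1] ⟶ [R, 1]` of the canonical map and `[Δ, 1]`. -/
def dualProduct {P Q R : A} (Δ : R ⟶ P ⊗ Q) :
    (ihom P).obj (𝟙_ A) ⊗ (ihom Q).obj (𝟙_ A) ⟶ (ihom R).obj (𝟙_ A) :=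
  MonoidalClosed.curry (dualPairing P Q) ≫ (MonoidalClosed.pre Δ).app (𝟙_ A)

theorem dualProduct_pre {P Q R T : A} (Δ : R ⟶ P ⊗ Q) (f : T ⟶ R) :
    dualProduct Δ ≫ (MonoidalClosed.pre f).app (𝟙_ A) = dualProduct (f ≫ Δ) := by
  simp [dualProduct, MonoidalClosed.pre_map]

theorem pre_dualProduct {P P' Q Q' R : A} (Δ : R ⟶ P ⊗ Q) (f : P ⟶ P') (g : Q ⟶ Q') :
    ((MonoidalClosed.pre f).app (𝟙_ A) ⊗ₘ (MonoidalClosed.pre g).app (𝟙_ A)) ≫ dualProduct Δ =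
      dualProduct (Δ ≫ (f ⊗ₘ g)) := by
  have key : ((MonoidalClosed.pre f).app (𝟙_ A) ⊗ₘ (MonoidalClosed.pre g).app (𝟙_ A)) ≫
      MonoidalClosed.curry (dualPairing P Q) =
        MonoidalClosed.curry (dualPairing P' Q') ≫ (MonoidalClosed.pre (f ⊗ₘ g)).app (𝟙_ A) := by
    rw [MonoidalClosed.curry_pre_app, ← MonoidalClosed.curry_natural_left]
    congr 1
    have h₁ := tensorμ_natural (𝟙 P) (𝟙 Q) ((MonoidalClosed.pre f).app (𝟙_ A))
      ((MonoidalClosed.pre g).app (𝟙_ A))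
    have h₂ := tensorμ_natural f g (𝟙 ((ihom P').obj (𝟙_ A))) (𝟙 ((ihom Q').obj (𝟙_ A)))
    simp only [id_tensorHom, tensorHom_id, id_whiskerRight] at h₁ h₂
    rw [dualPairing, dualPairing, reassoc_of% h₁, reassoc_of% h₂, tensorHom_comp_tensorHom_assoc,
      tensorHom_comp_tensorHom_assoc, MonoidalClosed.id_tensor_pre_app_comp_ev,
      MonoidalClosed.id_tensor_pre_app_comp_ev]
  rw [dualProduct, reassoc_of% key, dualProduct, MonoidalClosed.pre_map, NatTrans.comp_app]

end DualProduct

section Dual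

variable {A : Type u₂} [Category.{v₂} A] [Abelian A] [MonoidalCategory A]

/-- In a closed symmetric monoidal abelian category the tensor product is additive. -/
theorem monoidalPreadditive [BraidedCategory A] [MonoidalClosed A] : MonoidalPreadditive A := by
  have hl (P : A) : (tensorLeft P).Additive :=
    have := preservesBinaryBiproducts_of_preservesBinaryCoproducts (tensorLeft P)
    Functor.additive_of_preservesBinaryBiproducts _
  have hr {P Q R : A} (f : Q ⟶ R) : f ▷ P = (β_ Q P).hom ≫ P ◁ f ≫ (β_ R P).inv := by simp
  have h₀ {P Q R : A} : P ◁ (0 : Q ⟶ R) = 0 := (tensorLeft P).map_zero _ _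
  have h₁ {P Q R : A} (f g : Q ⟶ R) : P ◁ (f + g) = P ◁ f + P ◁ g := (tensorLeft P).map_add
  exact
    { whiskerLeft_zero := h₀
      zero_whiskerRight := by
        intros
        rw [hr, h₀, zero_comp, comp_zero]
      whiskerLeft_add := h₁
      add_whiskerRight := by
        intros
        rw [hr, h₁, Preadditive.add_comp, Preadditive.comp_add, ← hr, ← hr] }

variable [SymmetricCategory A] [MonoidalClosed A]

/-- The dual `[C, 1]` of a chain complex, with differential `[∂, 1]`. -/
def dualComplex (C : ChainComplex A ℕ) : CochainComplex A ℕ where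
  X n := (ihom (C.X n)).obj (𝟙_ A)
  d i j := (MonoidalClosed.pre (C.d j i)).app (𝟙_ A)
  shape i j hij := by
    have := monoidalPreadditive (A := A)
    rw [C.shape j i hij]
    apply MonoidalClosed.uncurry_injective
    simp [MonoidalClosed.uncurry_eq]
  d_comp_d' i j k _ _ := by
    have := monoidalPreadditive (A := A)
    rw [← NatTrans.comp_app, ← MonoidalClosed.pre_map, C.d_comp_d]
    apply MonoidalClosed.uncurry_injective
    simp [MonoidalClosed.uncurry_eq]

/-- Precomposition on internal homs is additive. -/
theorem pre_app_add {P Q : A} (f g : P ⟶ Q) (Z : A) :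
    (MonoidalClosed.pre (f + g)).app Z =
      (MonoidalClosed.pre f).app Z + (MonoidalClosed.pre g).app Z := by
  have := monoidalPreadditive (A := A)
  apply MonoidalClosed.uncurry_injective
  simp [MonoidalClosed.uncurry_eq]

/-- Precomposition on internal homs is additive. -/
theorem pre_app_zsmul {P Q : A} (m : ℤ) (f : P ⟶ Q) (Z : A) :
    (MonoidalClosed.pre (m • f)).app Z = m • (MonoidalClosed.pre f).app Z :=
  (AddMonoidHom.mk' (fun f : P ⟶ Q => (MonoidalClosed.pre f).app Z)
    fun f g => pre_app_add f g Z).map_zsmul m f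

theorem dualProduct_add {P Q R : A} (Δ Δ' : R ⟶ P ⊗ Q) :
    dualProduct (Δ + Δ') = dualProduct Δ + dualProduct Δ' := by
  rw [dualProduct, pre_app_add, Preadditive.comp_add, dualProduct, dualProduct]

theorem dualProduct_zsmul {P Q R : A} (m : ℤ) (Δ : R ⟶ P ⊗ Q) :
    dualProduct (m • Δ) = m • dualProduct Δ := by
  rw [dualProduct, pre_app_zsmul, Preadditive.comp_zsmul, dualProduct]

end Dual

section Homology

variable {A : Type u₂} [Category.{v₂} A] [Abelian A] [MonoidalCategory A]
  [SymmetricCategory A] [MonoidalClosed A]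

/-- A family of products on a cochain complex satisfying the Leibniz rule. -/
structure LeibnizProduct (K : CochainComplex A ℕ) where
  /-- The product. -/
  mul (p q n : ℕ) (h : p + q = n) : K.X p ⊗ K.X q ⟶ K.X n
  leibniz (p q n : ℕ) (h : p + q = n) :
    mul p q n h ≫ K.d n (n + 1) =
      K.d p (p + 1) ▷ K.X q ≫ mul (p + 1) q (n + 1) (by omega) +
      (-1 : ℤ) ^ p • K.X p ◁ K.d q (q + 1) ≫ mul p (q + 1) (n + 1) (by omega)

namespace LeibnizProduct

variable {K : CochainComplex A ℕ}

/-- A map out of `P ⊗ Z^q(K)` that vanishes on boundaries induces a map out of `P ⊗ H^q(K)`. -/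
def descRight {P Z : A} {q : ℕ} (f : P ⊗ K.cycles q ⟶ Z)
    (hf : ∀ i, i + 1 = q → P ◁ K.toCycles i q ≫ f = 0) : P ⊗ K.homology q ⟶ Z :=
  MonoidalClosed.uncurry ((K.homologyIsCokernel _ q rfl).desc
    (CokernelCofork.ofπ (MonoidalClosed.curry f) (by
      rw [← MonoidalClosed.curry_natural_left]
      by_cases hq : (ComplexShape.up ℕ).Rel ((ComplexShape.up ℕ).prev q) q
      · rw [hf _ hq]
        apply MonoidalClosed.uncurry_injective
        have := monoidalPreadditive (A := A)
        simp [MonoidalClosed.uncurry_eq]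
      · have := monoidalPreadditive (A := A)
        rw [K.toCycles_eq_zero hq]
        apply MonoidalClosed.uncurry_injective
        simp [MonoidalClosed.uncurry_eq])))

theorem π_descRight {P Z : A} {q : ℕ} (f : P ⊗ K.cycles q ⟶ Z)
    (hf : ∀ i, i + 1 = q → P ◁ K.toCycles i q ≫ f = 0) :
    P ◁ K.homologyπ q ≫ descRight f hf = f := by
  rw [descRight, ← MonoidalClosed.uncurry_natural_left]
  apply MonoidalClosed.curry_injective
  rw [MonoidalClosed.curry_uncurry]
  exact (K.homologyIsCokernel _ q rfl).fac _ WalkingParallelPair.one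

/-- A map out of `Z^p(K) ⊗ P` that vanishes on boundaries induces a map out of `H^p(K) ⊗ P`. -/
def descLeft {P Z : A} {p : ℕ} (f : K.cycles p ⊗ P ⟶ Z)
    (hf : ∀ i, i + 1 = p → K.toCycles i p ▷ P ≫ f = 0) : K.homology p ⊗ P ⟶ Z :=
  (β_ _ _).hom ≫ descRight ((β_ _ _).hom ≫ f) (fun i hi => by
    rw [BraidedCategory.braiding_naturality_right_assoc, hf i hi, comp_zero])

theorem π_descLeft {P Z : A} {p : ℕ} (f : K.cycles p ⊗ P ⟶ Z)
    (hf : ∀ i, i + 1 = p → K.toCycles i p ▷ P ≫ f = 0) :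
    K.homologyπ p ▷ P ≫ descLeft f hf = f := by
  rw [descLeft, BraidedCategory.braiding_naturality_left_assoc, π_descRight]
  simp

variable (M : LeibnizProduct K)

/-- The product of cocycles. -/
def cyclesMul (p q n : ℕ) (h : p + q = n) : K.cycles p ⊗ K.cycles q ⟶ K.cycles n :=
  K.liftCycles ((K.iCycles p ⊗ₘ K.iCycles q) ≫ M.mul p q n h) (n + 1) (by simp) (by
    have := monoidalPreadditive (A := A)
    rw [Category.assoc, M.leibniz]
    simp [tensorHom_comp_whiskerLeft_assoc, tensorHom_comp_whiskerRight_assoc])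

theorem cyclesMul_toCycles_right (p q n : ℕ) (h : p + q = n) (i : ℕ) (hi : i + 1 = q) :
    K.cycles p ◁ K.toCycles i q ≫ M.cyclesMul p q n h ≫ K.homologyπ n = 0 := by
  have := monoidalPreadditive (A := A)
  subst hi
  obtain rfl : p + i + 1 = n := by omega
  rw [cyclesMul, ← Category.assoc, HomologicalComplex.comp_liftCycles]
  refine K.liftCycles_homologyπ_eq_zero_of_boundary _ _ _
    ((-1 : ℤ) ^ p • K.iCycles p ▷ K.X i ≫ M.mul p i (p + i) rfl) ?_
  have h₀ : (-1 : ℤ) ^ p * (-1 : ℤ) ^ p = 1 := by rw [← mul_pow]; simp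
  rw [Preadditive.zsmul_comp, Category.assoc, M.leibniz, Preadditive.comp_add,
    ← comp_whiskerRight_assoc, K.iCycles_d, MonoidalPreadditive.zero_whiskerRight, zero_comp,
    zero_add, Preadditive.comp_zsmul, smul_smul, h₀, one_smul, tensorHom_def_assoc,
    whisker_exchange_assoc, ← MonoidalCategory.whiskerLeft_comp_assoc, K.toCycles_i]

theorem cyclesMul_toCycles_left (p q n : ℕ) (h : p + q = n) (i : ℕ) (hi : i + 1 = p) :
    K.toCycles i p ▷ K.cycles q ≫ M.cyclesMul p q n h ≫ K.homologyπ n = 0 := by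
  have := monoidalPreadditive (A := A)
  subst hi
  obtain rfl : i + q + 1 = n := by omega
  rw [cyclesMul, ← Category.assoc, HomologicalComplex.comp_liftCycles]
  refine K.liftCycles_homologyπ_eq_zero_of_boundary _ _ _
    (K.X i ◁ K.iCycles q ≫ M.mul i q (i + q) rfl) ?_
  rw [Category.assoc, M.leibniz, Preadditive.comp_add, Preadditive.comp_zsmul,
    ← MonoidalCategory.whiskerLeft_comp_assoc, K.iCycles_d, MonoidalPreadditive.whiskerLeft_zero,
    zero_comp, smul_zero, add_zero, tensorHom_def_assoc, ← comp_whiskerRight_assoc, K.toCycles_i,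
    whisker_exchange_assoc]

/-- The product induced on cohomology. -/
def homologyMul (p q n : ℕ) (h : p + q = n) : K.homology p ⊗ K.homology q ⟶ K.homology n :=
  descLeft (descRight (M.cyclesMul p q n h ≫ K.homologyπ n) (M.cyclesMul_toCycles_right p q n h))
    (fun i hi => by
      have := monoidalPreadditive (A := A)
      have : Epi (K.X i ◁ K.homologyπ q) :=
        inferInstanceAs (Epi ((tensorLeft (K.X i)).map (K.homologyπ q)))
      rw [← cancel_epi (K.X i ◁ K.homologyπ q), whisker_exchange_assoc, π_descRight,
        M.cyclesMul_toCycles_left p q n h i hi, comp_zero])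

/-- The product on cohomology is characterized by its values on classes of cocycles. -/
theorem π_homologyMul (p q n : ℕ) (h : p + q = n) :
    (K.homologyπ p ⊗ₘ K.homologyπ q) ≫ M.homologyMul p q n h =
      M.cyclesMul p q n h ≫ K.homologyπ n := by
  rw [tensorHom_def', Category.assoc, homologyMul, π_descLeft, π_descRight]

end LeibnizProduct

end Homology

section Magnitude

variable {V : Type u₁} [Category.{v₁} V] [SemiCartesianMonoidalCategory V]
variable {A : Type u₂} [Category.{v₂} A] [Abelian A] [MonoidalCategory A]
  [SymmetricCategory A] [MonoidalClosed A]
variable (S : V ⥤ A) [S.Monoidal]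
variable (X : Type w) [EnrichedCategory V X] [∀ k, HasCoproduct (summand S X k)]

/-- The magnitude chain complex `C_*^Σ(X)`. -/
def magnitudeChains : ChainComplex A ℕ :=
  ChainComplex.of (nerve S X) (boundary S X) (boundary_boundary S X)

/-- The magnitude cochain complex `C^*_Σ(X) = [C_*^Σ(X), 1]`. -/
def magnitudeCochains : CochainComplex A ℕ := dualComplex (magnitudeChains S X)

/-- The product `[Δ, 1]` on magnitude cochains. -/
def magnitudeCochainsProduct : LeibnizProduct (magnitudeCochains S X) where
  mul p q n h := dualProduct (coproduct S X p q n h)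
  leibniz p q n h := by
    have := monoidalPreadditive (A := A)
    have hd (k : ℕ) : (magnitudeCochains S X).d k (k + 1) =
        (MonoidalClosed.pre (boundary S X k)).app (𝟙_ A) := by
      simp only [magnitudeCochains, dualComplex, magnitudeChains, ChainComplex.of_d]
      rfl
    have h₁ := pre_dualProduct (coproduct S X (p + 1) q (n + 1) (by omega)) (boundary S X p)
      (𝟙 (nerve S X q))
    have h₂ := pre_dualProduct (coproduct S X p (q + 1) (n + 1) (by omega)) (𝟙 (nerve S X p))
      (boundary S X q)
    simp only [MonoidalClosed.pre_id, NatTrans.id_app, tensorHom_id, id_tensorHom] at h₁ h₂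
    rw [hd, hd, hd]
    refine (dualProduct_pre _ _).trans ?_
    refine (congrArg dualProduct (coproduct_boundary S X p q n h)).trans ?_
    refine (dualProduct_add _ _).trans ?_
    rw [dualProduct_zsmul]
    exact congrArg₂ (fun a b => a + (-1 : ℤ) ^ p • b) h₁.symm h₂.symm

/-- The magnitude cohomology `H^n_Σ(X)`. -/
def magnitudeCohomology (n : ℕ) : A := (magnitudeCochains S X).homology n

/-- The product `H^p_Σ(X) ⊗ H^q_Σ(X) ⟶ H^n_Σ(X)` for `p + q = n`. -/
def magnitudeProduct (p q n : ℕ) (h : p + q = n) :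
    magnitudeCohomology S X p ⊗ magnitudeCohomology S X q ⟶ magnitudeCohomology S X n :=
  (magnitudeCochainsProduct S X).homologyMul p q n h

end Magnitude

end MagnitudeCohomology

end

/-!
Commutativity is proved by Steenrod's cup-one homotopy on the level of chains.

Since `V` is cartesian, each product `X(y₀, y₁) ⊗ ⋯ ⊗ X(y_{n-1}, y_n)` is a product in `V`, and a
map into it is a composable string of generalized elements of hom-objects. Composing consecutive
entries of the string gives maps for all monotone maps of vertices (`pathProd.reindex`), which are
functorial (`pathProd.reindex_comp`). Hence the magnitude nerve is a simplicial object of `A`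
(`simplicialNerve`), whose faces are the given ones (`nerveFace_eq`). Every morphism of `V`
respects diagonals, so that the diagonals of these products induce a natural diagonal of the
nerve; it is cocommutative because `Σ` is braided (`nerveCocommutativeDiagonal`). As erasing an
outer vertex is a projection, the deconcatenation map is this diagonal followed by the front face
on one factor and the back face on the other (`coproduct_eq`), i.e. an Alexander-Whitney map.

For any simplicial object with a natural cocommutative diagonal, the alternating sum of the diagonal
followed by the faces `0, …, i, i + q, …, n` and `i, …, i + q` is a chain homotopy between this map
and its opposite (`CocommutativeDiagonal.cupOne_boundary`). Only faces occur, hence the argument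
works without dividing by degenerate simplices.

Dualizing, the homotopy contributes a coboundary to the product of two cocycles, together with terms
that vanish on cocycles (`dualProduct_comm_of_homotopy`), and cohomology is a quotient of cocycles
in a way that is preserved by tensor products (`LeibnizProduct.homologyMul_comm`).
-/

noncomputable section

namespace MagnitudeCohomology

/-! ### Strings of generalized elements of hom-objects -/

section Paths

open CartesianMonoidalCategory

variable {V : Type u₁} [Category.{v₁} V] [CartesianMonoidalCategory V]
variable {X : Type w} [EnrichedCategory V X]

theorem lift_eId_eComp {T : V} {x y : X} (f : T ⟶ EnrichedCategory.Hom x y) :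
    lift (toUnit T ≫ eId V x) f ≫ eComp V x x y = f := by
  have h : lift (toUnit T ≫ eId V x) f = f ≫ (λ_ _).inv ≫ eId V x ▷ _ := by
    ext
    · simp only [lift_fst, Category.assoc, whiskerRight_fst, leftUnitor_inv_fst_assoc,
        comp_toUnit_assoc]
    · simp
  rw [h, Category.assoc, Category.assoc, e_id_comp, Category.comp_id]

theorem lift_eComp_eId {T : V} {x y : X} (f : T ⟶ EnrichedCategory.Hom x y) :
    lift f (toUnit T ≫ eId V y) ≫ eComp V x y y = f := by
  have h : lift f (toUnit T ≫ eId V y) = f ≫ (ρ_ _).inv ≫ _ ◁ eId V y := by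
    ext
    · simp
    · simp only [lift_snd, Category.assoc, whiskerLeft_snd, rightUnitor_inv_snd_assoc,
        comp_toUnit_assoc]
  rw [h, Category.assoc, Category.assoc, e_comp_id, Category.comp_id]

theorem lift_eComp_assoc {T : V} {x y z t : X} (f : T ⟶ EnrichedCategory.Hom x y)
    (g : T ⟶ EnrichedCategory.Hom y z) (k : T ⟶ EnrichedCategory.Hom z t) :
    lift (lift f g ≫ eComp V x y z) k ≫ eComp V x z t =
      lift f (lift g k ≫ eComp V y z t) ≫ eComp V x y t := by
  have h₁ : lift (lift f g ≫ eComp V x y z) k =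
      lift f (lift g k) ≫ (α_ _ _ _).inv ≫ eComp V x y z ▷ _ := by
    rw [lift_lift_associator_inv_assoc, lift_whiskerRight]
  have h₂ : lift f (lift g k ≫ eComp V y z t) = lift f (lift g k) ≫ _ ◁ eComp V y z t := by
    rw [lift_whiskerLeft]
  rw [h₁, h₂, Category.assoc, Category.assoc, Category.assoc, e_assoc]

/-- The objects of a `V`-category `X`, regarded as the objects of the category whose morphisms
`x ⟶ y` are the generalized elements `T ⟶ X(x, y)` of the hom-objects of `X`. -/
@[nolint unusedArguments]
def ElementCategory (_ : V) (X : Type w) : Type w := X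

/-- Composition of generalized elements is pairing followed by the composition of `X`. -/
instance (T : V) : Category.{v₁} (ElementCategory T X) where
  Hom x y := T ⟶ (EnrichedCategory.Hom (C := X) x y : V)
  id x := toUnit T ≫ eId (C := X) V x
  comp {x y z} f g := lift f g ≫ eComp (C := X) V x y z
  id_comp f := lift_eId_eComp (X := X) f
  comp_id f := lift_eComp_eId (X := X) f
  assoc f g k := lift_eComp_assoc (X := X) f g k

variable (V) in
/-- The product `X(y₀, y₁) ⊗ (X(y₁, y₂) ⊗ (⋯ ⊗ (X(y_{n-1}, y_n) ⊗ 1)))`. -/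
def pathProd : (n : ℕ) → (Fin (n + 1) → X) → V
  | 0, _ => 𝟙_ V
  | n + 1, y => EnrichedCategory.Hom (y 0) (y (Fin.succ 0)) ⊗ pathProd n (y ∘ Fin.succ)

namespace pathProd

/-- The projection to the factor `X(y_k, y_{k+1})`. -/
def proj : (n : ℕ) → (y : Fin (n + 1) → X) → (k : Fin n) →
    (pathProd V n y ⟶ EnrichedCategory.Hom (y k.castSucc) (y k.succ))
  | n + 1, y, k => Fin.cases (motive := fun k : Fin (n + 1) =>
        pathProd V (n + 1) y ⟶ EnrichedCategory.Hom (y k.castSucc) (y k.succ))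
      (fst _ _) (fun k => snd _ _ ≫ proj n (y ∘ Fin.succ) k) k

/-- The map with prescribed projections. -/
def tuple {T : V} : (n : ℕ) → (y : Fin (n + 1) → X) →
    (∀ k : Fin n, T ⟶ EnrichedCategory.Hom (y k.castSucc) (y k.succ)) → (T ⟶ pathProd V n y)
  | 0, _, _ => toUnit T
  | n + 1, y, e => lift (e 0) (tuple n (y ∘ Fin.succ) fun k => e k.succ)

theorem tuple_proj {T : V} (n : ℕ) (y : Fin (n + 1) → X)
    (e : ∀ k : Fin n, T ⟶ EnrichedCategory.Hom (y k.castSucc) (y k.succ)) (k : Fin n) :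
    tuple n y e ≫ proj n y k = e k := by
  induction n with
  | zero => exact k.elim0
  | succ n ih =>
    induction k using Fin.cases with
    | zero => exact lift_fst _ _
    | succ k =>
      exact (lift_snd_assoc _ _ _).trans (ih (y ∘ Fin.succ) (fun k => e k.succ) k)

theorem hom_ext {T : V} {n : ℕ} {y : Fin (n + 1) → X} {f g : T ⟶ pathProd V n y}
    (h : ∀ k, f ≫ proj n y k = g ≫ proj n y k) : f = g := by
  induction n with
  | zero => exact toUnit_unique f g
  | succ n ih =>
    refine CartesianMonoidalCategory.hom_ext _ _ (h 0) (ih fun k => ?_)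
    exact (Category.assoc _ _ _).trans ((h k.succ).trans (Category.assoc _ _ _).symm)

/-- The universal string `y₀ ⟶ y₁ ⟶ ⋯ ⟶ y_n` of generalized elements of hom-objects. -/
def universalString (n : ℕ) (y : Fin (n + 1) → X) :
    ComposableArrows (ElementCategory (pathProd V n y) X) n :=
  ComposableArrows.mkOfObjOfMapSucc (C := ElementCategory (pathProd V n y) X) y
    fun k => proj n y k

/-- The composition map `X(y₀, y₁) ⊗ ⋯ ⊗ X(y_{n-1}, y_n) ⟶ X(y_a, y_b)` for `a ≤ b`. If `a = b`,
it is given by the identity of `y_a`. -/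
def segment {n : ℕ} (y : Fin (n + 1) → X) {a b : Fin (n + 1)} (h : a ≤ b) :
    pathProd V n y ⟶ EnrichedCategory.Hom (y a) (y b) :=
  (universalString n y).map (homOfLE h)

theorem segment_self {n : ℕ} (y : Fin (n + 1) → X) (a : Fin (n + 1)) :
    segment (V := V) y (le_refl a) = toUnit _ ≫ eId V (y a) :=
  (universalString n y).map_id a

theorem segment_comp {n : ℕ} (y : Fin (n + 1) → X) {a b c : Fin (n + 1)} (h : a ≤ b)
    (h' : b ≤ c) : lift (segment (V := V) y h) (segment y h') ≫ eComp V (y a) (y b) (y c) =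
      segment y (h.trans h') :=
  ((universalString n y).map_comp (homOfLE h) (homOfLE h')).symm

theorem segment_succ {n : ℕ} (y : Fin (n + 1) → X) (k : Fin n) :
    segment (V := V) y (Fin.castSucc_le_succ k) = proj n y k :=
  ComposableArrows.mkOfObjOfMapSucc_map_succ (C := ElementCategory (pathProd V n y) X) y
    (fun k => proj n y k) k k.2

/-- The map `X(y₀, y₁) ⊗ ⋯ ⊗ X(y_{n-1}, y_n) ⟶ X(y_{f 0}, y_{f 1}) ⊗ ⋯ ⊗ X(y_{f (m-1)}, y_{f m})`
induced by a monotone map `f`. -/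
def reindex {m n : ℕ} (f : Fin (m + 1) →o Fin (n + 1)) (y : Fin (n + 1) → X) :
    pathProd V n y ⟶ pathProd V m (y ∘ f) :=
  tuple m (y ∘ f) fun k => segment y (f.monotone (Fin.castSucc_le_succ k))

theorem reindex_proj {m n : ℕ} (f : Fin (m + 1) →o Fin (n + 1)) (y : Fin (n + 1) → X)
    (k : Fin m) : reindex (V := V) f y ≫ proj m (y ∘ f) k =
      segment y (f.monotone (Fin.castSucc_le_succ k)) :=
  tuple_proj _ _ _ _

/-- Composing consecutive factors after reindexing composes longer segments: both sides are
compatible with composition and agree on single factors. -/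
theorem reindex_segment {m n : ℕ} (f : Fin (m + 1) →o Fin (n + 1)) (y : Fin (n + 1) → X)
    {a b : Fin (m + 1)} (h : a ≤ b) :
    reindex (V := V) f y ≫ segment (y ∘ f) h = segment y (f.monotone h) := by
  obtain ⟨a, ha⟩ := a
  obtain ⟨b, hb⟩ := b
  have hab : a ≤ b := h
  induction b, hab using Nat.le_induction with
  | base =>
    rw [segment_self, segment_self]
    simp [← Category.assoc]
  | succ b hab ih =>
    have h₁ : (⟨a, ha⟩ : Fin (m + 1)) ≤ ⟨b, by omega⟩ := hab
    have h₂ : (⟨b, by omega⟩ : Fin (m + 1)) ≤ ⟨b + 1, hb⟩ := Nat.le_succ b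
    have e := ih (by omega) h₁
    have e' := (congrArg (reindex (V := V) f y ≫ ·)
      (segment_succ (V := V) (y ∘ f) ⟨b, by omega⟩)).trans (reindex_proj f y _)
    rw [← segment_comp (y ∘ f) h₁ h₂, ← segment_comp y (f.monotone h₁) (f.monotone h₂), ← e]
    erw [← e']
    simp only [comp_lift_assoc, Function.comp_apply]

theorem reindex_id {n : ℕ} (y : Fin (n + 1) → X) :
    reindex (V := V) OrderHom.id y = 𝟙 (pathProd V n y) :=
  hom_ext fun k => (reindex_proj _ _ _).trans ((segment_succ y k).trans (Category.id_comp _).symm)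

theorem reindex_comp {l m n : ℕ} (f : Fin (m + 1) →o Fin (n + 1)) (g : Fin (l + 1) →o Fin (m + 1))
    (y : Fin (n + 1) → X) :
    reindex (V := V) f y ≫ reindex g (y ∘ f) = reindex (f.comp g) y :=
  hom_ext fun k => (Category.assoc _ _ _).trans <|
    (congrArg (reindex f y ≫ ·) (reindex_proj g (y ∘ f) k)).trans <|
    (reindex_segment f y (g.monotone (Fin.castSucc_le_succ k))).trans
      (reindex_proj (V := V) (f.comp g) y k).symm

end pathProd

end Paths

/-! ### Comparison with the tensor products of the magnitude nerve -/

section VertexMaps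

/-- The increasing map of natural numbers that misses exactly `k`, defined by recursion, so that
its values at `0` and at successors reduce definitionally. -/
def skipNat : ℕ → ℕ → ℕ
  | 0, v => v + 1
  | _ + 1, 0 => 0
  | k + 1, v + 1 => skipNat k v + 1

theorem skipNat_eq (k v : ℕ) : skipNat k v = if v < k then v else v + 1 := by
  induction k generalizing v with
  | zero => simp [skipNat]
  | succ k ih =>
    cases v with
    | zero => simp [skipNat]
    | succ v =>
      rw [skipNat, ih]
      split_ifs <;> omega

/-- The increasing map `[n] ⟶ [n + 1]` that misses `k`. -/
def skip (n k : ℕ) : Fin (n + 1) →o Fin (n + 2) where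
  toFun v := ⟨skipNat k v, by rw [skipNat_eq]; split_ifs <;> omega⟩
  monotone' a b h := by
    have h' : (a : ℕ) ≤ b := h
    simp only [Fin.mk_le_mk, skipNat_eq]
    split_ifs <;> omega

/-- The inclusion of `[p]` as the first vertices of `[q + p]`. -/
def front (p q : ℕ) : Fin (p + 1) →o Fin (q + p + 1) where
  toFun v := ⟨v, by omega⟩
  monotone' _ _ h := h

/-- The inclusion of `[q]` as the last vertices of `[q + p]`. -/
def back (p q : ℕ) : Fin (q + 1) →o Fin (q + p + 1) where
  toFun v := ⟨v + p, by omega⟩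
  monotone' _ _ h := Nat.add_le_add_right h p

end VertexMaps

section Paths

open CartesianMonoidalCategory

variable {V : Type u₁} [Category.{v₁} V] [CartesianMonoidalCategory V]
variable {X : Type w} [EnrichedCategory V X]

theorem lift_fst_comp_eq {P Q R M : V} (m : P ⊗ Q ⟶ M) :
    lift (fst P (Q ⊗ R)) (snd P (Q ⊗ R) ≫ fst Q R) ≫ m =
      ((α_ P Q R).inv ≫ m ▷ R) ≫ fst M R := by
  rw [Category.assoc, whiskerRight_fst, ← Category.assoc]
  congr 1
  ext <;> simp

namespace pathProd

/-- Erasing the first vertex projects away the first factor. -/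
theorem reindex_skip_zero (n : ℕ) (y : Fin (n + 2) → X) :
    reindex (V := V) (skip n 0) y = snd _ _ :=
  hom_ext fun k => (reindex_proj _ _ _).trans (segment_succ y k.succ)

/-- A composition of factors that does not involve the first factor. -/
theorem segment_tail {n : ℕ} (y : Fin (n + 2) → X) {a b : Fin (n + 1)} (h : a ≤ b) :
    segment (V := V) y (Fin.succ_le_succ_iff.mpr h) = snd _ _ ≫ segment (y ∘ Fin.succ) h := by
  rw [← reindex_skip_zero]
  exact (reindex_segment (skip n 0) y h).symm

theorem segment_one {n : ℕ} (y : Fin (n + 2) → X) (h : (0 : Fin (n + 2)) ≤ Fin.succ 0) :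
    segment (V := V) y h = fst _ _ :=
  segment_succ y 0

theorem reindex_skip_one (n : ℕ) (y : Fin (n + 3) → X) :
    reindex (V := V) (skip (n + 1) 1) y =
      (α_ _ _ _).inv ≫ eComp V (y 0) (y (Fin.succ 0)) (y (Fin.succ (Fin.succ 0))) ▷
        pathProd V n (y ∘ Fin.succ ∘ Fin.succ) := by
  refine hom_ext fun k => (reindex_proj _ _ _).trans ?_
  induction k using Fin.cases with
  | zero =>
    have h₁ : (0 : Fin (n + 3)) ≤ Fin.succ 0 := Fin.zero_le _
    have h₂ : (Fin.succ 0 : Fin (n + 3)) ≤ Fin.succ (Fin.succ 0) :=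
      Fin.succ_le_succ_iff.mpr (Fin.zero_le _)
    refine (segment_comp (V := V) y h₁ h₂).symm.trans ?_
    rw [segment_one]
    erw [segment_tail (V := V) y (a := 0) (b := Fin.succ 0) (Fin.zero_le _), segment_one]
    exact lift_fst_comp_eq _
  | succ k =>
    refine (segment_succ (V := V) y k.succ.succ).trans ?_
    refine Eq.trans ?_ (Category.assoc _ _ _).symm
    erw [whiskerRight_snd_assoc, associator_inv_snd_assoc]
    rfl

theorem reindex_skip_succ (n k : ℕ) (y : Fin (n + 3) → X) :
    reindex (V := V) (skip (n + 1) (k + 2)) y =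
      EnrichedCategory.Hom (y 0) (y (Fin.succ 0)) ◁
        reindex (skip n (k + 1)) (y ∘ Fin.succ) := by
  refine hom_ext fun j => (reindex_proj _ _ _).trans ?_
  induction j using Fin.cases with
  | zero =>
    refine (segment_succ (V := V) y 0).trans ?_
    exact (whiskerLeft_fst _ _).symm
  | succ j =>
    refine (segment_tail (V := V) y
      ((skip n (k + 1)).monotone (Fin.castSucc_le_succ j))).trans ?_
    refine Eq.trans ?_ (whiskerLeft_snd_assoc _ _ _).symm
    exact congrArg (snd _ _ ≫ ·) (reindex_proj _ _ _).symm

theorem reindex_front_succ (p q : ℕ) (y : Fin (q + p + 2) → X) :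
    reindex (V := V) (front (p + 1) q) y =
      EnrichedCategory.Hom (y 0) (y (Fin.succ 0)) ◁ reindex (front p q) (y ∘ Fin.succ) := by
  refine hom_ext fun j => (reindex_proj _ _ _).trans ?_
  induction j using Fin.cases with
  | zero =>
    refine (segment_succ (V := V) y 0).trans ?_
    exact (whiskerLeft_fst _ _).symm
  | succ j =>
    refine (segment_tail (V := V) y ((front p q).monotone (Fin.castSucc_le_succ j))).trans ?_
    refine Eq.trans ?_ (whiskerLeft_snd_assoc _ _ _).symm
    exact congrArg (snd _ _ ≫ ·) (reindex_proj _ _ _).symm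

theorem reindex_back_succ (p q : ℕ) (y : Fin (q + p + 2) → X) :
    reindex (V := V) (back (p + 1) q) y = snd _ _ ≫ reindex (back p q) (y ∘ Fin.succ) := by
  exact (reindex_comp (skip (q + p) 0) (back p q) y).symm.trans
    (congrArg (· ≫ reindex (back p q) (y ∘ Fin.succ)) (reindex_skip_zero (q + p) y))

theorem reindex_back_zero (q : ℕ) (y : Fin (q + 1) → X) :
    reindex (V := V) (back 0 q) y = 𝟙 _ :=
  reindex_id y

end pathProd

variable {A : Type u₂} [Category.{v₂} A] [MonoidalCategory A]
variable (S : V ⥤ A) [S.Monoidal]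

/-- The list `[y₁, …, y_n]`. -/
def vertexTail : (n : ℕ) → (Fin (n + 1) → X) → List X
  | 0, _ => []
  | n + 1, y => y (Fin.succ 0) :: vertexTail n (y ∘ Fin.succ)

theorem length_vertexTail (n : ℕ) (y : Fin (n + 1) → X) : (vertexTail n y).length = n := by
  induction n with
  | zero => rfl
  | succ n ih => simp [vertexTail, ih]

/-- The comparison `Σ (X(y₀, y₁) ⊗ ⋯ ⊗ X(y_{n-1}, y_n)) ≅ Σ X(y₀, y₁) ⊗ ⋯ ⊗ Σ X(y_{n-1}, y_n)`. -/
def pathIso : (n : ℕ) → (y : Fin (n + 1) → X) →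
    (S.obj (pathProd V n y) ≅ pathObj S (y 0) (vertexTail n y))
  | 0, _ => (Functor.Monoidal.εIso S).symm
  | n + 1, y => (Functor.Monoidal.μIso S _ _).symm ≪≫
      whiskerLeftIso (homObj S (y 0) (y (Fin.succ 0))) (pathIso n (y ∘ Fin.succ))

/-- A projection is the erasing of a factor by way of the augmentation. -/
theorem map_snd (P Q : V) : S.map (snd P Q) =
    Functor.OplaxMonoidal.δ S P Q ≫ (S.map (toUnit P) ≫ Functor.OplaxMonoidal.η S) ▷ S.obj Q ≫
      (λ_ _).hom := by
  rw [← whiskerRight_toUnit_comp_leftUnitor_hom, S.map_comp, Functor.Monoidal.map_leftUnitor,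
    Functor.Monoidal.map_whiskerRight]
  simp

theorem δ_augmentation {P Q : V} {T : A} (φ : S.obj Q ⟶ T) :
    (Functor.OplaxMonoidal.δ S P Q ≫ S.obj P ◁ φ) ≫
        (S.map (toUnit P) ≫ Functor.OplaxMonoidal.η S) ▷ T ≫ (λ_ T).hom =
      S.map (snd P Q) ≫ φ := by
  rw [Category.assoc, aux_aug, map_snd]
  simp only [Category.assoc]

theorem pathIso_firstFace (n : ℕ) (y : Fin (n + 2) → X) :
    (pathIso S (n + 1) y).hom ≫ firstFace S (y 0) (vertexTail (n + 1) y) =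
      S.map (pathProd.reindex (skip n 0) y) ≫ (pathIso S n (y ∘ Fin.succ)).hom := by
  rw [pathProd.reindex_skip_zero]
  exact δ_augmentation S _

theorem δ_composition {P Q R M : V} {T Z : A} (φ : S.obj R ⟶ T) (m : P ⊗ Q ⟶ M)
    (g : S.obj M ⊗ T ⟶ Z) :
    (Functor.OplaxMonoidal.δ S P (Q ⊗ R) ≫
        S.obj P ◁ (Functor.OplaxMonoidal.δ S Q R ≫ S.obj Q ◁ φ)) ≫
          ((α_ _ _ _).inv ≫ (Functor.LaxMonoidal.μ S P Q ≫ S.map m) ▷ T) ≫ g =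
      S.map ((α_ P Q R).inv ≫ m ▷ R) ≫ (Functor.OplaxMonoidal.δ S M R ≫ S.obj M ◁ φ) ≫ g := by
  simp only [Functor.map_comp, Functor.Monoidal.map_whiskerRight,
    Functor.Monoidal.map_associator_inv, Category.assoc, Functor.Monoidal.μ_δ_assoc,
    comp_whiskerRight, MonoidalCategory.whiskerLeft_comp]
  simp [← whisker_exchange_assoc]

/-- Erasing the second vertex. For `n = 0` it is the last one, and both sides are projections;
otherwise the first two factors are composed. As in the definition of the nerve, the map `g`
replaces the equality of the two lists of vertices, which is not definitional. -/
theorem pathIso_secondFace (n : ℕ) (y : Fin (n + 2) → X) {Z : A}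
    (g : ∀ l, pathObj S (y 0) l ⟶ Z) :
    (pathIso S (n + 1) y).hom ≫ secondFace S (y 0) (vertexTail (n + 1) y) ≫ g _ =
      S.map (pathProd.reindex (skip n 1) y) ≫ (pathIso S n (y ∘ skip n 1)).hom ≫
        g (vertexTail n (y ∘ skip n 1)) := by
  cases n with
  | zero =>
    have h : pathProd.reindex (V := V) (skip 0 1) y = snd _ _ := toUnit_unique _ _
    rw [h]
    exact aux_assoc (δ_augmentation S (Functor.OplaxMonoidal.η S)) (g [])
  | succ n =>
    rw [pathProd.reindex_skip_one]
    exact δ_composition S _ _ (g (y (Fin.succ (Fin.succ 0)) ::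
      vertexTail n (y ∘ Fin.succ ∘ Fin.succ)))

theorem unit_rebracket {Q : V} {T Z : A} (φ : S.obj Q ⟶ T) (g : 𝟙_ A ⊗ T ⟶ Z) :
    φ ≫ (λ_ T).inv ≫ g = S.map (lift (toUnit Q) (𝟙 Q)) ≫ Functor.OplaxMonoidal.δ S (𝟙_ V) Q ≫
      (Functor.OplaxMonoidal.η S ⊗ₘ φ) ≫ g := by
  have h : lift (toUnit Q) (𝟙 Q) = (λ_ Q).inv := by ext; simp
  rw [h, Functor.Monoidal.map_leftUnitor_inv]
  simp [MonoidalCategory.tensorHom_def]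

variable [MonoidalClosed A]

theorem δ_whiskerLeft_congr {ι : Type w} {P Q Q' : V} {Q₁ : A} {M : ι → A} {l l' : ι}
    {φ : S.obj Q ⟶ Q₁} {L : Q₁ ⟶ M l} {r : Q ⟶ Q'} {φ' : S.obj Q' ⟶ M l'}
    (h : ∀ {Z : A} (g : ∀ l, M l ⟶ Z), φ ≫ L ≫ g l = S.map r ≫ φ' ≫ g l') {Z : A}
    (g : ∀ l, S.obj P ⊗ M l ⟶ Z) :
    (Functor.OplaxMonoidal.δ S P Q ≫ S.obj P ◁ φ) ≫ S.obj P ◁ L ≫ g l =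
      S.map (P ◁ r) ≫ (Functor.OplaxMonoidal.δ S P Q' ≫ S.obj P ◁ φ') ≫ g l' := by
  rw [Category.assoc, aux_whiskerLeft_congr h g]
  simp

/-- Erasing a vertex other than the first one. -/
theorem pathIso_laterFace (i n : ℕ) (h : i ≤ n) (y : Fin (n + 2) → X) {Z : A}
    (g : ∀ l, pathObj S (y 0) l ⟶ Z) :
    (pathIso S (n + 1) y).hom ≫ laterFace S i (y 0) (vertexTail (n + 1) y) ≫ g _ =
      S.map (pathProd.reindex (skip n (i + 1)) y) ≫ (pathIso S n (y ∘ skip n (i + 1))).hom ≫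
        g (vertexTail n (y ∘ skip n (i + 1))) := by
  induction i generalizing n Z with
  | zero => exact pathIso_secondFace S n y g
  | succ i ih =>
    obtain _ | n := n
    · omega
    · rw [pathProd.reindex_skip_succ]
      exact δ_whiskerLeft_congr S (fun g => ih n (by omega) (y ∘ Fin.succ) g)
        (fun l => g (y (Fin.succ 0) :: l))

theorem δ_whiskerLeft_rebracket {ι : Type w} {P Q Q₁ Q₂ : V} {M N : ι → A} {a b : ι}
    {T : A} {φ : S.obj Q ⟶ T} {r : T ⟶ M b ⊗ N b} {f : Q ⟶ Q₁} {k : Q ⟶ Q₂}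
    {φ₁ : S.obj Q₁ ⟶ M a} {φ₂ : S.obj Q₂ ⟶ N a}
    (h : ∀ {Z : A} (g : ∀ l, M l ⊗ N l ⟶ Z), φ ≫ r ≫ g b =
      S.map (lift f k) ≫ Functor.OplaxMonoidal.δ S Q₁ Q₂ ≫ (φ₁ ⊗ₘ φ₂) ≫ g a) {Z : A}
    (g : ∀ l, (S.obj P ⊗ M l) ⊗ N l ⟶ Z) :
    (Functor.OplaxMonoidal.δ S P Q ≫ S.obj P ◁ φ) ≫ (S.obj P ◁ r ≫ (α_ _ _ _).inv) ≫ g b =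
      S.map (lift (P ◁ f) (snd P Q ≫ k)) ≫ Functor.OplaxMonoidal.δ S (P ⊗ Q₁) Q₂ ≫
        ((Functor.OplaxMonoidal.δ S P Q₁ ≫ S.obj P ◁ φ₁) ⊗ₘ φ₂) ≫ g a := by
  have h' := aux_whiskerLeft_congr (P := S.obj P) (M := fun l => M l ⊗ N l)
    (e₁ := φ) (f₁ := r) (e₂ := S.map (lift f k))
    (f₂ := Functor.OplaxMonoidal.δ S Q₁ Q₂ ≫ (φ₁ ⊗ₘ φ₂))
    (fun g => (h g).trans (by simp only [Category.assoc])) fun l => (α_ _ _ _).inv ≫ g l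
  have e : lift (P ◁ f) (snd P Q ≫ k) = P ◁ lift f k ≫ (α_ P Q₁ Q₂).inv := by ext <;> simp
  simp only [Category.assoc] at h' ⊢
  rw [h', e]
  simp only [Functor.map_comp, Functor.Monoidal.map_whiskerLeft,
    Functor.Monoidal.map_associator_inv, Category.assoc, Functor.Monoidal.μ_δ_assoc,
    MonoidalCategory.whiskerLeft_comp]
  simp [MonoidalCategory.tensorHom_def]

/-- Rebracketing is the diagonal followed by the projections to the first `p` and the last `q`
factors. -/
theorem pathIso_rebracket (p q : ℕ) (y : Fin (q + p + 1) → X) {Z : A}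
    (g : ∀ m : List X × X × List X, pathObj S (y 0) m.1 ⊗ pathObj S m.2.1 m.2.2 ⟶ Z) :
    (pathIso S (q + p) y).hom ≫ rebracket S p (y 0) (vertexTail (q + p) y) ≫ g (_, _, _) =
      S.map (lift (pathProd.reindex (front p q) y) (pathProd.reindex (back p q) y)) ≫
        Functor.OplaxMonoidal.δ S _ _ ≫
          ((pathIso S p (y ∘ front p q)).hom ⊗ₘ (pathIso S q (y ∘ back p q)).hom) ≫
        g (vertexTail p (y ∘ front p q), (y ∘ back p q) 0, vertexTail q (y ∘ back p q)) := by
  induction p generalizing Z with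
  | zero =>
    have h : pathProd.reindex (V := V) (front 0 q) y = toUnit _ := toUnit_unique _ _
    have h' : pathProd.reindex (V := V) (back 0 q) y = 𝟙 _ := pathProd.reindex_back_zero q y
    rw [h]
    erw [h']
    exact unit_rebracket S _ (g ([], y 0, vertexTail q y))
  | succ p ih =>
    have h := pathProd.reindex_front_succ (V := V) p q y
    have h' := pathProd.reindex_back_succ (V := V) p q y
    rw [h]
    erw [h']
    exact δ_whiskerLeft_rebracket S (M := fun m : List X × X × List X =>
        pathObj S (y (Fin.succ 0)) m.1) (N := fun m : List X × X × List X => pathObj S m.2.1 m.2.2)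
      (a := (vertexTail p ((y ∘ Fin.succ) ∘ front p q), ((y ∘ Fin.succ) ∘ back p q) 0,
        vertexTail q ((y ∘ Fin.succ) ∘ back p q)))
      (b := ((vertexTail (q + p) (y ∘ Fin.succ)).take p,
        entry p ((y ∘ Fin.succ) 0) (vertexTail (q + p) (y ∘ Fin.succ)),
        (vertexTail (q + p) (y ∘ Fin.succ)).drop p))
      (fun g => ih (y ∘ Fin.succ) g)
      (fun m : List X × X × List X => g (y (Fin.succ 0) :: m.1, m.2))

end Paths

/-! ### The magnitude nerve as a simplicial object with diagonal -/

section SimplicialNerve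

open CartesianMonoidalCategory Opposite Simplicial

theorem vertexTail_injective {X : Type w} (n : ℕ) :
    Function.Injective fun y : Fin (n + 1) → X => (y 0, vertexTail n y) := by
  induction n with
  | zero =>
    intro y z h
    funext k
    obtain rfl : k = 0 := Fin.fin_one_eq_zero k
    exact (Prod.ext_iff.mp h).1
  | succ n ih =>
    intro y z h
    have h' := ih (a₁ := y ∘ Fin.succ) (a₂ := z ∘ Fin.succ)
      (Prod.ext (List.cons.inj (Prod.ext_iff.mp h).2).1 (List.cons.inj (Prod.ext_iff.mp h).2).2)
    funext k
    induction k using Fin.cases with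
    | zero => exact (Prod.ext_iff.mp h).1
    | succ k => exact congrFun h' k

theorem exists_vertexTail {X : Type w} (x : X) (l : List X) :
    ∃ y : Fin (l.length + 1) → X, y 0 = x ∧ vertexTail l.length y = l := by
  induction l generalizing x with
  | nil => exact ⟨fun _ => x, rfl, rfl⟩
  | cons z l ih =>
    obtain ⟨y, h, h'⟩ := ih z
    refine ⟨Fin.cons x y, rfl, ?_⟩
    change y 0 :: vertexTail l.length y = z :: l
    rw [h, h']

/-- Sequences `y₀, …, y_n`, written as functions and as a first entry and a list. -/
def simplexEquiv (X : Type w) (n : ℕ) : (Fin (n + 1) → X) ≃ Simplex X n :=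
  Equiv.ofBijective (fun y => ⟨(y 0, vertexTail n y), length_vertexTail n y⟩) <| by
    refine ⟨fun y z h => vertexTail_injective n (Subtype.ext_iff.mp h), ?_⟩
    rintro ⟨⟨x, l⟩, rfl⟩
    obtain ⟨y, h, h'⟩ := exists_vertexTail x l
    exact ⟨y, Subtype.ext (Prod.ext h h')⟩

variable {V : Type u₁} [Category.{v₁} V] [CartesianMonoidalCategory V]
variable {A : Type u₂} [Category.{v₂} A] [MonoidalCategory A]
variable (S : V ⥤ A) [S.Monoidal]
variable {X : Type w} [EnrichedCategory V X] [∀ k, HasCoproduct (summand S X k)]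

/-- The inclusion of `Σ (X(y₀, y₁) ⊗ ⋯ ⊗ X(y_{n-1}, y_n))` into the magnitude nerve. -/
def pathIncl (n : ℕ) (y : Fin (n + 1) → X) : S.obj (pathProd V n y) ⟶ nerve S X n :=
  (pathIso S n y).hom ≫ incl S n (y 0) (vertexTail n y) (length_vertexTail n y)

variable {S} in
theorem pathIncl_hom_ext {n : ℕ} {Z : A} {f g : nerve S X n ⟶ Z}
    (h : ∀ y, pathIncl S n y ≫ f = pathIncl S n y ≫ g) : f = g :=
  Sigma.hom_ext _ _ fun s => by
    obtain ⟨y, rfl⟩ := (simplexEquiv X n).surjective s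
    exact (cancel_epi (pathIso S n y).hom).mp <|
      (Category.assoc _ _ _).symm.trans ((h y).trans (Category.assoc _ _ _))

variable {S} in
/-- The map out of the magnitude nerve with prescribed components. -/
def pathDesc {n : ℕ} {Z : A} (f : ∀ y : Fin (n + 1) → X, S.obj (pathProd V n y) ⟶ Z) :
    nerve S X n ⟶ Z :=
  Cofan.IsColimit.desc (Cofan.isColimitEquivOfEquiv (simplexEquiv X n) _
    (coproductIsCoproduct (summand S X n))) fun y => (pathIso S n y).inv ≫ f y

variable {S} in
theorem pathIncl_pathDesc {n : ℕ} {Z : A}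
    (f : ∀ y : Fin (n + 1) → X, S.obj (pathProd V n y) ⟶ Z) (y : Fin (n + 1) → X) :
    pathIncl S n y ≫ pathDesc f = f y := by
  have h : incl S n (y 0) (vertexTail n y) (length_vertexTail n y) ≫ pathDesc f =
      (pathIso S n y).inv ≫ f y :=
    Cofan.IsColimit.fac (Cofan.isColimitEquivOfEquiv (simplexEquiv X n) _
      (coproductIsCoproduct (summand S X n))) (fun y => (pathIso S n y).inv ≫ f y) y
  rw [pathIncl, Category.assoc, h, Iso.hom_inv_id_assoc]

/-- The map of magnitude nerves induced by a monotone map of vertices. -/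
def nerveMap {m n : ℕ} (f : Fin (m + 1) →o Fin (n + 1)) : nerve S X n ⟶ nerve S X m :=
  pathDesc fun y => S.map (pathProd.reindex f y) ≫ pathIncl S m (y ∘ f)

theorem pathIncl_nerveMap {m n : ℕ} (f : Fin (m + 1) →o Fin (n + 1)) (y : Fin (n + 1) → X) :
    pathIncl S n y ≫ nerveMap S f = S.map (pathProd.reindex f y) ≫ pathIncl S m (y ∘ f) :=
  pathIncl_pathDesc _ y

variable (X) in
/-- The magnitude nerve, with all face and degeneracy maps. -/
def simplicialNerve : SimplicialObject A where
  obj n := nerve S X n.unop.len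
  map f := nerveMap S f.unop.toOrderHom
  map_id n := pathIncl_hom_ext fun y => by
    rw [pathIncl_nerveMap, Category.comp_id]
    have h : S.map (pathProd.reindex OrderHom.id y) ≫ pathIncl S n.unop.len y =
        pathIncl S n.unop.len y := by
      have h' : S.map (pathProd.reindex OrderHom.id y) = 𝟙 (S.obj (pathProd V n.unop.len y)) :=
        (congrArg S.map (pathProd.reindex_id y)).trans (S.map_id _)
      exact (congrArg (· ≫ pathIncl S n.unop.len y) h').trans (Category.id_comp _)
    exact h
  map_comp {l m n} f g := pathIncl_hom_ext fun y => by
    rw [← Category.assoc, pathIncl_nerveMap, pathIncl_nerveMap, Category.assoc, pathIncl_nerveMap,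
      ← S.map_comp_assoc, pathProd.reindex_comp]
    rfl

variable (X) in
/-- The diagonal of the magnitude nerve, induced by the diagonals of the objects of `V`. -/
def nerveDiagonal (n : ℕ) : nerve S X n ⟶ nerve S X n ⊗ nerve S X n :=
  pathDesc fun y => S.map (lift (𝟙 _) (𝟙 _)) ≫ Functor.OplaxMonoidal.δ S _ _ ≫
    (pathIncl S n y ⊗ₘ pathIncl S n y)

theorem pathIncl_nerveDiagonal (n : ℕ) (y : Fin (n + 1) → X) :
    pathIncl S n y ≫ nerveDiagonal S X n = S.map (lift (𝟙 _) (𝟙 _)) ≫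
      Functor.OplaxMonoidal.δ S _ _ ≫ (pathIncl S n y ⊗ₘ pathIncl S n y) :=
  pathIncl_pathDesc _ y

theorem pathIncl_nerveDiagonal_nerveMap {m m' n : ℕ} (f : Fin (m + 1) →o Fin (n + 1))
    (g : Fin (m' + 1) →o Fin (n + 1)) (y : Fin (n + 1) → X) :
    pathIncl S n y ≫ nerveDiagonal S X n ≫ (nerveMap S f ⊗ₘ nerveMap S g) =
      S.map (lift (pathProd.reindex f y) (pathProd.reindex g y)) ≫
        Functor.OplaxMonoidal.δ S _ _ ≫ (pathIncl S m (y ∘ f) ⊗ₘ pathIncl S m' (y ∘ g)) := by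
  have h : lift (pathProd.reindex (V := V) f y) (pathProd.reindex g y) =
      lift (𝟙 _) (𝟙 _) ≫ (pathProd.reindex f y ⊗ₘ pathProd.reindex g y) := by simp
  rw [← Category.assoc, pathIncl_nerveDiagonal, h, S.map_comp]
  simp only [Category.assoc, tensorHom_comp_tensorHom, pathIncl_nerveMap]
  rw [← tensorHom_comp_tensorHom, Functor.OplaxMonoidal.δ_natural_assoc]

theorem nerveMap_nerveDiagonal {m n : ℕ} (f : Fin (m + 1) →o Fin (n + 1)) :
    nerveMap S f ≫ nerveDiagonal S X m =
      nerveDiagonal S X n ≫ (nerveMap S f ⊗ₘ nerveMap S f) :=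
  pathIncl_hom_ext fun y => by
    rw [pathIncl_nerveDiagonal_nerveMap, ← Category.assoc, pathIncl_nerveMap, Category.assoc,
      pathIncl_nerveDiagonal, ← S.map_comp_assoc, comp_lift, Category.comp_id]

theorem nerveFace_zero_eq (n : ℕ) : nerveFace S X n 0 = nerveMap S (skip n 0) :=
  pathIncl_hom_ext fun y => by
    rw [pathIncl_nerveMap, pathIncl, Category.assoc, incl_nerveFace_zero]
    exact aux_assoc (pathIso_firstFace S n y) _

theorem nerveFace_succ_eq [Preadditive A] [MonoidalClosed A] (n : ℕ) (i : Fin (n + 1)) :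
    nerveFace S X n i.succ = nerveMap S (skip n (i + 1)) :=
  pathIncl_hom_ext fun y => by
    have h := pathIso_laterFace S i n (by omega) y (fun l => inclTotal S n (y 0, l))
    rw [inclTotal_eq S n _ _ ?_, inclTotal_eq S n _ _ ?_] at h
    · rw [pathIncl_nerveMap, pathIncl, Category.assoc, incl_nerveFace_succ]
      exact h

theorem nerveFace_eq [Preadditive A] [MonoidalClosed A] (n : ℕ) (i : Fin (n + 2)) :
    nerveFace S X n i = nerveMap S (skip n i) := by
  induction i using Fin.cases with
  | zero => exact nerveFace_zero_eq S n
  | succ i => exact nerveFace_succ_eq S n i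

/-- Deconcatenation is an Alexander-Whitney map: the diagonal followed by the front
face and the back face. -/
theorem coproduct_eq [Preadditive A] [MonoidalClosed A] (p q : ℕ) :
    coproduct S X p q (q + p) (Nat.add_comm p q) =
      nerveDiagonal S X (q + p) ≫ (nerveMap S (front p q) ⊗ₘ nerveMap S (back p q)) :=
  pathIncl_hom_ext fun y => by
    have h := pathIso_rebracket S p q y (fun m => inclTensor S p q ((y 0, m.1), m.2))
    rw [inclTensor_eq S p q _ _ _ _ ?_ ?_, inclTensor_eq S p q _ _ _ _ ?_ ?_] at h
    · rw [pathIncl_nerveDiagonal_nerveMap, pathIncl, Category.assoc, incl_coproduct]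
      refine h.trans ?_
      exact congrArg (S.map _ ≫ Functor.OplaxMonoidal.δ S _ _ ≫ ·)
        (tensorHom_comp_tensorHom _ _ _ _)
    · exact length_vertexTail _ _
    · exact length_vertexTail _ _

end SimplicialNerve

section Cocommutative

open CartesianMonoidalCategory

variable {V : Type u₁} [Category.{v₁} V] [CartesianMonoidalCategory V] [SymmetricCategory V]
variable {A : Type u₂} [Category.{v₂} A] [MonoidalCategory A] [SymmetricCategory A]
variable (S : V ⥤ A) [S.Braided]
variable (X : Type w) [EnrichedCategory V X] [∀ k, HasCoproduct (summand S X k)]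

theorem nerveDiagonal_braiding (n : ℕ) :
    nerveDiagonal S X n ≫ (β_ _ _).hom = nerveDiagonal S X n :=
  pathIncl_hom_ext fun y => by
    have h : lift (𝟙 (pathProd V n y)) (𝟙 _) ≫ (β_ _ _).hom = lift (𝟙 _) (𝟙 _) := by simp
    rw [← Category.assoc, pathIncl_nerveDiagonal, Category.assoc, Category.assoc,
      BraidedCategory.braiding_naturality]
    conv_rhs => rw [← h, S.map_comp, Functor.map_braiding]
    simp

end Cocommutative

/-! ### Cancellation of alternating sums -/

section AlternatingSums

variable {M : Type*} [AddCommGroup M]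

/-- The cancellation behind the cup-one homotopy. The families `a`, `L` and `R` stand for the terms
of `∂ D`, of `D (∂ ⊗ 1)` and of `D (1 ⊗ ∂)`, where `i` numbers the summands of `D` and `k` the
faces. -/
theorem alternating_sum_cancel (p q : ℕ) (a L R : ℕ → ℕ → M)
    (h₁ : ∀ i k, k ≤ i → i < p → a i k = L (i + 1) k)
    (h₂ : ∀ i k, i < p → k < q → a i (i + 1 + k) = R i (k + 1))
    (h₃ : ∀ i k, i + k < p → a i (i + 1 + q + k) = L i (i + 2 + k))
    (h₄ : ∀ i, i < p → L (i + 1) (i + 1) = R i 0)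
    (h₅ : ∀ i, i < p → L i (i + 1) = R i (q + 1)) :
    (-1 : ℤ) ^ (q + 1) • ∑ i ∈ Finset.range (p + 1), (-1 : ℤ) ^ ((q + 1) * i) •
        ∑ k ∈ Finset.range (p + 2), (-1 : ℤ) ^ k • L i k +
      ∑ i ∈ Finset.range p, (-1 : ℤ) ^ ((q + 1 + 1) * i) •
        ∑ k ∈ Finset.range (q + 2), (-1 : ℤ) ^ k • R i k =
    ∑ i ∈ Finset.range p, (-1 : ℤ) ^ ((q + 1) * i) •
        ∑ k ∈ Finset.range (p + q + 1), (-1 : ℤ) ^ k • a i k +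
      (-1 : ℤ) ^ q • ((-1 : ℤ) ^ (p * q) • L p (p + 1) - L 0 0) := by
  -- The terms of `L i` are split into the faces below `i`, the faces `i` and `i + 1`, and the faces
  -- above `i + 1`; those of `R i` into the two outer faces and the inner ones.
  let lo (i : ℕ) : M := ∑ k ∈ Finset.range i, (-1 : ℤ) ^ k • L i k
  let hi (i : ℕ) : M := ∑ k ∈ Finset.range (p - i), (-1 : ℤ) ^ (i + k) • L i (i + 2 + k)
  let mid (i : ℕ) : M := ∑ k ∈ Finset.range q, (-1 : ℤ) ^ (k + 1) • R i (k + 1)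
  have hL : ∀ i ∈ Finset.range (p + 1), (-1 : ℤ) ^ ((q + 1) * i) •
      ∑ k ∈ Finset.range (p + 2), (-1 : ℤ) ^ k • L i k =
      (-1 : ℤ) ^ ((q + 1) * i) • lo i + (-1 : ℤ) ^ (q * i) • L i i -
        (-1 : ℤ) ^ (q * i) • L i (i + 1) + (-1 : ℤ) ^ ((q + 1) * i) • hi i := by
    intro i hi'
    have hi' := Finset.mem_range.mp hi'
    obtain ⟨c, rfl⟩ : ∃ c, p = i + c := ⟨p - i, by omega⟩
    have e : ∑ k ∈ Finset.range c, (-1 : ℤ) ^ (i + 2 + k) • L i (i + 2 + k) = hi i := by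
      simp only [hi, Nat.add_sub_cancel_left]
      refine Finset.sum_congr rfl fun k _ => ?_
      rw [show i + 2 + k = i + k + 2 by omega, pow_add _ _ 2]
      simp
    rw [show i + c + 2 = i + 2 + c by omega, Finset.sum_range_add, e, Finset.sum_range_succ,
      Finset.sum_range_succ]
    obtain h | h := neg_one_pow_eq_or ℤ i <;>
      simp only [add_mul, one_mul, pow_succ, pow_add, h, lo] <;> module
  have hR : ∀ i ∈ Finset.range p, (-1 : ℤ) ^ ((q + 1 + 1) * i) •
      ∑ k ∈ Finset.range (q + 2), (-1 : ℤ) ^ k • R i k =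
      (-1 : ℤ) ^ (q * i) • (L (i + 1) (i + 1) + mid i + (-1 : ℤ) ^ (q + 1) • L i (i + 1)) := by
    intro i hi'
    have hi' := Finset.mem_range.mp hi'
    rw [Finset.sum_range_succ, Finset.sum_range_succ', h₄ i hi', h₅ i hi']
    congr 1
    · obtain h | h := neg_one_pow_eq_or ℤ i <;> simp [add_mul, pow_add, h]
    · simp only [mid, pow_zero, one_smul]
      abel
  have ha : ∀ i ∈ Finset.range p, (-1 : ℤ) ^ ((q + 1) * i) •
      ∑ k ∈ Finset.range (p + q + 1), (-1 : ℤ) ^ k • a i k =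
      (-1 : ℤ) ^ ((q + 1) * i) • (lo (i + 1) + (-1 : ℤ) ^ i • mid i +
        (-1 : ℤ) ^ (q + 1) • hi i) := by
    intro i hi'
    have hi' := Finset.mem_range.mp hi'
    obtain ⟨c, rfl⟩ : ∃ c, p = i + c := ⟨p - i, by omega⟩
    rw [show i + c + q + 1 = i + 1 + q + c by omega, Finset.sum_range_add, Finset.sum_range_add]
    congr 3
    · exact Finset.sum_congr rfl fun k hk => by
        rw [h₁ i k (Nat.lt_succ_iff.mp (Finset.mem_range.mp hk)) hi']
    · rw [Finset.smul_sum]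
      exact Finset.sum_congr rfl fun k hk => by
        rw [h₂ i k hi' (Finset.mem_range.mp hk), smul_smul, ← pow_add]
        congr 2
        omega
    · simp only [hi, Nat.add_sub_cancel_left]
      rw [Finset.smul_sum]
      exact Finset.sum_congr rfl fun k hk => by
        rw [h₃ i k (by have := Finset.mem_range.mp hk; omega), smul_smul, ← pow_add]
        congr 2
        omega
  have hlo : lo 0 = 0 := rfl
  have hhi : hi p = 0 := by simp [hi]
  rw [Finset.sum_congr rfl hL, Finset.sum_congr rfl hR, Finset.sum_congr rfl ha]
  simp only [Finset.sum_add_distrib, Finset.sum_sub_distrib]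
  rw [Finset.sum_range_succ' (fun i => (-1 : ℤ) ^ ((q + 1) * i) • lo i),
    Finset.sum_range_succ' (fun i => (-1 : ℤ) ^ (q * i) • L i i),
    Finset.sum_range_succ (fun i => (-1 : ℤ) ^ (q * i) • L i (i + 1)),
    Finset.sum_range_succ (fun i => (-1 : ℤ) ^ ((q + 1) * i) • hi i), hlo, hhi]
  -- For fixed `i`, the two special faces of `L` cancel against the outer faces of `R`; the special
  -- faces that were split off at the ends of the range remain.
  have key : ∀ i, (-1 : ℤ) ^ (q + 1) • ((-1 : ℤ) ^ ((q + 1) * (i + 1)) • lo (i + 1) +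
      (-1 : ℤ) ^ (q * (i + 1)) • L (i + 1) (i + 1) - (-1 : ℤ) ^ (q * i) • L i (i + 1) +
        (-1 : ℤ) ^ ((q + 1) * i) • hi i) +
      (-1 : ℤ) ^ (q * i) • (L (i + 1) (i + 1) + mid i + (-1 : ℤ) ^ (q + 1) • L i (i + 1)) =
      (-1 : ℤ) ^ ((q + 1) * i) • (lo (i + 1) + (-1 : ℤ) ^ i • mid i +
        (-1 : ℤ) ^ (q + 1) • hi i) := by
    intro i
    obtain h | h := neg_one_pow_eq_or ℤ i <;> obtain h' | h' := neg_one_pow_eq_or ℤ q <;>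
      simp [add_mul, mul_add, pow_add, pow_mul, h, h'] <;> abel
  rw [← Finset.sum_congr rfl fun i _ => key i]
  simp only [Finset.sum_add_distrib, Finset.sum_sub_distrib, Finset.smul_sum, smul_add, smul_sub,
    smul_zero, mul_zero, pow_zero, one_smul, mul_comm q p]
  module

end AlternatingSums

/-! ### The cup-one homotopy -/

section CupOne

open Simplicial

/-- The map `[m] ⟶ [n]` that sends the vertex `v` to `f v`. Values above `n` are replaced by `n`,
so that no bound on `f` has to be carried along. -/
def vertexMap (m n : ℕ) (f : ℕ →o ℕ) : ⦋m⦌ ⟶ ⦋n⦌ :=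
  SimplexCategory.mkHom
    { toFun v := ⟨min (f v) n, by omega⟩
      monotone' v w h := min_le_min_right n (f.monotone h) }

/-- The increasing map that misses exactly `k`. -/
def skipHom (k : ℕ) : ℕ →o ℕ where
  toFun v := if v < k then v else v + 1
  monotone' v w h := by
    dsimp only
    split_ifs <;> omega

/-- The map `v ↦ i + v`. -/
def shiftHom (i : ℕ) : ℕ →o ℕ where
  toFun v := i + v
  monotone' _ _ h := Nat.add_le_add_left h i

/-- The map with values `0, …, i, i + q, i + q + 1, …`. -/
def gapHom (i q : ℕ) : ℕ →o ℕ where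
  toFun v := if v ≤ i then v else v + q - 1
  monotone' v w h := by
    dsimp only
    split_ifs <;> omega

theorem skipHom_apply (k v : ℕ) : skipHom k v = if v < k then v else v + 1 := rfl

theorem shiftHom_apply (i v : ℕ) : shiftHom i v = i + v := rfl

theorem gapHom_apply (i q v : ℕ) : gapHom i q v = if v ≤ i then v else v + q - 1 := rfl

theorem vertexMap_comp (l m n : ℕ) (f g k : ℕ →o ℕ)
    (h : ∀ v ≤ l, min (f (min (g v) m)) n = min (k v) n) :
    vertexMap l m g ≫ vertexMap m n f = vertexMap l n k := by
  ext v
  exact h v (by have := v.2; simp at this; omega)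

theorem vertexMap_congr (m n : ℕ) (f g : ℕ →o ℕ) (h : ∀ v ≤ m, min (f v) n = min (g v) n) :
    vertexMap m n f = vertexMap m n g := by
  ext v
  exact h v (by have := v.2; simp at this; omega)

variable {A : Type u₂} [Category.{v₂} A]

/-- The map of a simplicial object induced by a map of vertices. -/
def vertexFace (C : SimplicialObject A) (m n : ℕ) (f : ℕ →o ℕ) : C _⦋n⦌ ⟶ C _⦋m⦌ :=
  C.map (vertexMap m n f).op

theorem vertexFace_comp (C : SimplicialObject A) {l m n : ℕ} {f g k : ℕ →o ℕ}
    (h : ∀ v ≤ l, min (f (min (g v) m)) n = min (k v) n) :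
    vertexFace C m n f ≫ vertexFace C l m g = vertexFace C l n k := by
  rw [vertexFace, vertexFace, ← C.map_comp, ← op_comp, vertexMap_comp l m n f g k h, vertexFace]

/-- The alternating sum of the faces of a simplicial object. -/
def alternatingFaces [Preadditive A] (C : SimplicialObject A) (n : ℕ) : C _⦋n + 1⦌ ⟶ C _⦋n⦌ :=
  ∑ k ∈ Finset.range (n + 2), (-1 : ℤ) ^ k • vertexFace C n (n + 1) (skipHom k)

variable [MonoidalCategory A] [SymmetricCategory A]

/-- A natural cocommutative diagonal of a simplicial object. (Coassociativity and a counit play no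
role in the homotopy below.) -/
structure CocommutativeDiagonal (C : SimplicialObject A) where
  /-- The diagonal. -/
  diag (n : ℕ) : C _⦋n⦌ ⟶ C _⦋n⦌ ⊗ C _⦋n⦌
  map_diag {m n : ℕ} (f : ⦋m⦌ ⟶ ⦋n⦌) :
    C.map f.op ≫ diag m = diag n ≫ (C.map f.op ⊗ₘ C.map f.op)
  diag_braiding (n : ℕ) : diag n ≫ (β_ _ _).hom = diag n

namespace CocommutativeDiagonal

variable {C : SimplicialObject A} (δ : CocommutativeDiagonal C)

/-- The diagonal followed by the faces with vertices `f 0, …, f p` and `g 0, …, g q`. -/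
def split (n p q : ℕ) (f g : ℕ →o ℕ) : C _⦋n⦌ ⟶ C _⦋p⦌ ⊗ C _⦋q⦌ :=
  δ.diag n ≫ (vertexFace C p n f ⊗ₘ vertexFace C q n g)

theorem split_congr {n p q : ℕ} {f f' g g' : ℕ →o ℕ} (h : ∀ v ≤ p, min (f v) n = min (f' v) n)
    (h' : ∀ v ≤ q, min (g v) n = min (g' v) n) : δ.split n p q f g = δ.split n p q f' g' := by
  rw [split, split, vertexFace, vertexFace, vertexMap_congr p n f f' h, vertexMap_congr q n g g' h']
  rfl

theorem vertexFace_split {m n p q : ℕ} {f g g' k k' : ℕ →o ℕ}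
    (h : ∀ v ≤ p, min (f (min (g v) m)) n = min (k v) n)
    (h' : ∀ v ≤ q, min (f (min (g' v) m)) n = min (k' v) n) :
    vertexFace C m n f ≫ δ.split m p q g g' = δ.split n p q k k' := by
  have e : vertexFace C m n f ≫ δ.diag m =
      δ.diag n ≫ (vertexFace C m n f ⊗ₘ vertexFace C m n f) := δ.map_diag _
  rw [split, reassoc_of% e, tensorHom_comp_tensorHom, vertexFace_comp C h, vertexFace_comp C h',
    split]

theorem split_whiskerRight {n p p' q : ℕ} {f g k k' : ℕ →o ℕ}
    (h : ∀ v ≤ p', min (f (min (k v) p)) n = min (k' v) n) :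
    δ.split n p q f g ≫ vertexFace C p' p k ▷ C _⦋q⦌ = δ.split n p' q k' g := by
  rw [split, Category.assoc, tensorHom_comp_whiskerRight, vertexFace_comp C h, split]

theorem split_whiskerLeft {n p q q' : ℕ} {f g k k' : ℕ →o ℕ}
    (h : ∀ v ≤ q', min (g (min (k v) q)) n = min (k' v) n) :
    δ.split n p q f g ≫ C _⦋p⦌ ◁ vertexFace C q' q k = δ.split n p q' f k' := by
  rw [split, Category.assoc, tensorHom_comp_whiskerLeft, vertexFace_comp C h, split]

theorem split_braiding (n p q : ℕ) (f g : ℕ →o ℕ) :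
    δ.split n p q f g ≫ (β_ _ _).hom = δ.split n q p g f := by
  rw [split, Category.assoc, BraidedCategory.braiding_naturality, ← Category.assoc,
    δ.diag_braiding, split]

variable [Preadditive A]

/-- Steenrod's cup-one homotopy `D : C_n ⟶ C_p ⊗ C_q` for `p + q = n + 1`, the alternating sum of
the maps to the faces `0, …, i, i + q, …, n` and `i, …, i + q`. For `q = 0` these two faces would
repeat the vertex `i`; that part of the homotopy is zero. -/
def cupOne (p q n : ℕ) : C _⦋n⦌ ⟶ C _⦋p⦌ ⊗ C _⦋q⦌ :=
  if q = 0 then 0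
  else ∑ i ∈ Finset.range p, (-1 : ℤ) ^ ((q + 1) * i) • δ.split n p q (gapHom i q) (shiftHom i)

theorem cupOne_zero (p n : ℕ) : δ.cupOne p 0 n = 0 := if_pos rfl

theorem cupOne_of_pos (p q n : ℕ) (hq : 0 < q) : δ.cupOne p q n =
    ∑ i ∈ Finset.range p, (-1 : ℤ) ^ ((q + 1) * i) • δ.split n p q (gapHom i q) (shiftHom i) :=
  if_neg hq.ne'

theorem alternatingFaces_cupOne (p q n : ℕ) (hq : 0 < q) :
    alternatingFaces C n ≫ δ.cupOne p q n =
      ∑ i ∈ Finset.range p, (-1 : ℤ) ^ ((q + 1) * i) •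
        ∑ k ∈ Finset.range (n + 2), (-1 : ℤ) ^ k •
          (vertexFace C n (n + 1) (skipHom k) ≫
            δ.split n p q (gapHom i q) (shiftHom i)) := by
  rw [cupOne_of_pos δ _ _ _ hq, alternatingFaces]
  simp only [Preadditive.sum_comp, Preadditive.zsmul_comp, Preadditive.comp_sum,
    Preadditive.comp_zsmul]

variable [MonoidalPreadditive A]

theorem cupOne_whiskerRight (p q n : ℕ) (hq : 0 < q) :
    δ.cupOne (p + 1) q n ≫ alternatingFaces C p ▷ C _⦋q⦌ =
      ∑ i ∈ Finset.range (p + 1), (-1 : ℤ) ^ ((q + 1) * i) •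
        ∑ k ∈ Finset.range (p + 2), (-1 : ℤ) ^ k •
          (δ.split n (p + 1) q (gapHom i q) (shiftHom i) ≫
            vertexFace C p (p + 1) (skipHom k) ▷ C _⦋q⦌) := by
  have e : alternatingFaces C p ▷ C _⦋q⦌ = ∑ k ∈ Finset.range (p + 2), (-1 : ℤ) ^ k •
      vertexFace C p (p + 1) (skipHom k) ▷ C _⦋q⦌ := by
    change (tensorRight (C _⦋q⦌)).map _ = _
    simp only [alternatingFaces, Functor.map_sum, Functor.map_zsmul]
    rfl
  rw [cupOne_of_pos δ _ _ _ hq, e]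
  rw [Preadditive.sum_comp]
  simp only [Preadditive.zsmul_comp]
  simp only [Preadditive.comp_sum, Preadditive.comp_zsmul]

theorem cupOne_whiskerLeft (p q n : ℕ) :
    δ.cupOne p (q + 1) n ≫ C _⦋p⦌ ◁ alternatingFaces C q =
      ∑ i ∈ Finset.range p, (-1 : ℤ) ^ ((q + 1 + 1) * i) •
        ∑ k ∈ Finset.range (q + 2), (-1 : ℤ) ^ k •
          (δ.split n p (q + 1) (gapHom i (q + 1)) (shiftHom i) ≫
            C _⦋p⦌ ◁ vertexFace C q (q + 1) (skipHom k)) := by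
  have e : C _⦋p⦌ ◁ alternatingFaces C q = ∑ k ∈ Finset.range (q + 2), (-1 : ℤ) ^ k •
      C _⦋p⦌ ◁ vertexFace C q (q + 1) (skipHom k) := by
    change (tensorLeft (C _⦋p⦌)).map _ = _
    simp only [alternatingFaces, Functor.map_sum, Functor.map_zsmul]
    rfl
  rw [cupOne_of_pos δ _ _ _ (Nat.succ_pos q), e]
  rw [Preadditive.sum_comp]
  simp only [Preadditive.zsmul_comp]
  simp only [Preadditive.comp_sum, Preadditive.comp_zsmul]

/-- The cup-one homotopy relates the Alexander-Whitney map and its opposite. -/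
theorem cupOne_boundary (p q n : ℕ) (h : p + q = n + 1) :
    (-1 : ℤ) ^ (q + 1) • δ.cupOne (p + 1) q (n + 1) ≫ alternatingFaces C p ▷ C _⦋q⦌ +
      δ.cupOne p (q + 1) (n + 1) ≫ C _⦋p⦌ ◁ alternatingFaces C q =
    alternatingFaces C n ≫ δ.cupOne p q n +
      (-1 : ℤ) ^ q • ((-1 : ℤ) ^ (p * q) • δ.split (n + 1) p q OrderHom.id (shiftHom p) -
        δ.split (n + 1) q p OrderHom.id (shiftHom q) ≫ (β_ _ _).hom) := by
  obtain rfl | hq := Nat.eq_zero_or_pos q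
  -- For `q = 0`, only the part of the homotopy with second factor an edge `i, i + 1` remains, and
  -- its boundary telescopes.
  · obtain rfl : p = n + 1 := h
    have e : ∀ i ∈ Finset.range (n + 1), (-1 : ℤ) ^ ((0 + 1 + 1) * i) •
        ∑ k ∈ Finset.range (0 + 2), (-1 : ℤ) ^ k •
          (δ.split (n + 1) (n + 1) (0 + 1) (gapHom i (0 + 1)) (shiftHom i) ≫
            C _⦋n + 1⦌ ◁ vertexFace C 0 (0 + 1) (skipHom k)) =
        δ.split (n + 1) (n + 1) 0 OrderHom.id (shiftHom (i + 1)) -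
          δ.split (n + 1) (n + 1) 0 OrderHom.id (shiftHom i) := by
      intro i hi
      have hi := Finset.mem_range.mp hi
      have e₀ : δ.split (n + 1) (n + 1) (0 + 1) (gapHom i (0 + 1)) (shiftHom i) ≫
          C _⦋n + 1⦌ ◁ vertexFace C 0 (0 + 1) (skipHom 0) =
            δ.split (n + 1) (n + 1) 0 OrderHom.id (shiftHom (i + 1)) := by
        rw [split_whiskerLeft (k' := shiftHom (i + 1))]
        · apply split_congr
          · intro v hv
            simp only [gapHom_apply, OrderHom.id_coe, id]
            grind
          · exact fun _ _ => rfl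
        · intro v hv
          simp only [shiftHom_apply, skipHom_apply]
          grind
      have e₁ : δ.split (n + 1) (n + 1) (0 + 1) (gapHom i (0 + 1)) (shiftHom i) ≫
          C _⦋n + 1⦌ ◁ vertexFace C 0 (0 + 1) (skipHom 1) =
            δ.split (n + 1) (n + 1) 0 OrderHom.id (shiftHom i) := by
        rw [split_whiskerLeft (k' := shiftHom i)]
        · apply split_congr
          · intro v hv
            simp only [gapHom_apply, OrderHom.id_coe, id]
            grind
          · exact fun _ _ => rfl
        · intro v hv
          simp only [shiftHom_apply, skipHom_apply]
          grind
      rw [Finset.sum_range_succ, Finset.sum_range_one]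
      erw [e₀, e₁]
      simp [pow_mul, sub_eq_add_neg]
    rw [cupOne_zero, cupOne_zero, cupOne_whiskerLeft, Finset.sum_congr rfl e,
      Finset.sum_range_sub fun i => δ.split (n + 1) (n + 1) 0 OrderHom.id (shiftHom i),
      split_braiding]
    have e₂ : δ.split (n + 1) (n + 1) 0 OrderHom.id (shiftHom 0) =
        δ.split (n + 1) (n + 1) 0 (shiftHom 0) OrderHom.id := by
      apply split_congr <;> intro v hv <;> simp [shiftHom_apply]
    rw [e₂]
    simp
  · rw [cupOne_whiskerRight δ _ _ _ hq, cupOne_whiskerLeft, alternatingFaces_cupOne δ _ _ _ hq,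
      show n + 2 = p + q + 1 by omega]
    -- The terms left over at the two ends are the Alexander-Whitney map and its opposite.
    have eL : δ.split (n + 1) p q OrderHom.id (shiftHom p) =
        δ.split (n + 1) (p + 1) q (gapHom p q) (shiftHom p) ≫
            vertexFace C p (p + 1) (skipHom (p + 1)) ▷ C _⦋q⦌ := by
      rw [split_whiskerRight]
      intro v hv
      simp only [gapHom_apply, skipHom_apply, OrderHom.id_coe, id]
      grind
    have eR : δ.split (n + 1) q p OrderHom.id (shiftHom q) ≫ (β_ _ _).hom =
        δ.split (n + 1) (p + 1) q (gapHom 0 q) (shiftHom 0) ≫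
            vertexFace C p (p + 1) (skipHom 0) ▷ C _⦋q⦌ := by
      rw [split_whiskerRight (k' := shiftHom q), split_braiding]
      · apply split_congr <;> intro v hv <;> simp [shiftHom_apply]
      · intro v hv
        simp only [gapHom_apply, skipHom_apply, shiftHom_apply]
        grind
    rw [eL, eR]
    refine alternating_sum_cancel p q
      (fun i k => vertexFace C n (n + 1) (skipHom k) ≫
            δ.split n p q (gapHom i q) (shiftHom i))
      (fun i k => δ.split (n + 1) (p + 1) q (gapHom i q) (shiftHom i) ≫
            vertexFace C p (p + 1) (skipHom k) ▷ C _⦋q⦌)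
      (fun i k => δ.split (n + 1) p (q + 1) (gapHom i (q + 1)) (shiftHom i) ≫
            C _⦋p⦌ ◁ vertexFace C q (q + 1) (skipHom k)) ?_ ?_ ?_ ?_ ?_
    · intro i k hk hi
      rw [vertexFace_split δ (k := (gapHom (i + 1) q).comp (skipHom k)) (k' := shiftHom (i + 1)),
        split_whiskerRight δ (k' := (gapHom (i + 1) q).comp (skipHom k))]
      all_goals
        intro v hv
        simp only [gapHom_apply, skipHom_apply, shiftHom_apply, OrderHom.comp_coe,
          Function.comp_apply]
        grind
    · intro i k hi hk
      rw [vertexFace_split δ (k := gapHom i (q + 1)) (k' := (shiftHom i).comp (skipHom (k + 1))),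
        split_whiskerLeft δ (k' := (shiftHom i).comp (skipHom (k + 1)))]
      all_goals
        intro v hv
        simp only [gapHom_apply, skipHom_apply, shiftHom_apply, OrderHom.comp_coe,
          Function.comp_apply]
        grind
    · intro i k hk
      rw [vertexFace_split δ (k := (gapHom i q).comp (skipHom (i + 2 + k))) (k' := shiftHom i),
        split_whiskerRight δ (k' := (gapHom i q).comp (skipHom (i + 2 + k)))]
      all_goals
        intro v hv
        simp only [gapHom_apply, skipHom_apply, shiftHom_apply, OrderHom.comp_coe,
          Function.comp_apply]
        grind
    · intro i hi
      rw [split_whiskerRight δ (k' := gapHom i (q + 1)),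
        split_whiskerLeft δ (k' := shiftHom (i + 1))]
      all_goals
        intro v hv
        simp only [gapHom_apply, skipHom_apply, shiftHom_apply]
        grind
    · intro i hi
      rw [split_whiskerRight δ (k' := gapHom i (q + 1)),
        split_whiskerLeft δ (k' := shiftHom i)]
      all_goals
        intro v hv
        simp only [gapHom_apply, skipHom_apply, shiftHom_apply]
        grind

end CocommutativeDiagonal

end CupOne

/-! ### Graded commutativity -/

section DualBraiding

variable {A : Type u₂} [Category.{v₂} A] [MonoidalCategory A] [SymmetricCategory A]

theorem braiding_tensorμ (P Q P' Q' : A) :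
    ((β_ P Q).hom ⊗ₘ (β_ P' Q').hom) ≫ tensorμ Q P Q' P' =
      tensorμ P Q P' Q' ≫ (β_ (P ⊗ P') (Q ⊗ Q')).hom := by
  simp [tensorμ, SymmetricCategory.braiding_swap_eq_inv_braiding Q P',
    MonoidalCategory.tensorHom_def]

variable [MonoidalClosed A]

/-- The evaluation pairing of `P ⊗ Q` is symmetric under a simultaneous exchange on both sides. -/
theorem braiding_dualPairing (P Q : A) :
    ((β_ P Q).hom ⊗ₘ (β_ ((ihom P).obj (𝟙_ A)) ((ihom Q).obj (𝟙_ A))).hom) ≫ dualPairing Q P =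
      dualPairing P Q := by
  have h : (β_ (𝟙_ A) (𝟙_ A)).hom ≫ (λ_ (𝟙_ A)).hom = (λ_ (𝟙_ A)).hom := by
    rw [braiding_leftUnitor, unitors_equal]
  rw [dualPairing, dualPairing, reassoc_of% braiding_tensorμ P Q,
    ← BraidedCategory.braiding_naturality_assoc]
  exact congrArg (_ ≫ _ ≫ ·) h

theorem dualProduct_braiding {P Q R : A} (Δ : R ⟶ P ⊗ Q) :
    dualProduct (Δ ≫ (β_ P Q).hom) = (β_ _ _).hom ≫ dualProduct Δ := by
  have key : MonoidalClosed.curry (dualPairing Q P) ≫ (MonoidalClosed.pre (β_ P Q).hom).app _ =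
      (β_ _ _).hom ≫ MonoidalClosed.curry (dualPairing P Q) := by
    rw [MonoidalClosed.curry_pre_app, ← MonoidalClosed.curry_natural_left,
      ← braiding_dualPairing P Q, ← id_tensorHom, tensorHom_comp_tensorHom_assoc]
    simp [tensorHom_id]
  rw [dualProduct, MonoidalClosed.pre_map, NatTrans.comp_app, reassoc_of% key, dualProduct]

end DualBraiding

section DualHomotopy

variable {A : Type u₂} [Category.{v₂} A] [Abelian A] [MonoidalCategory A] [SymmetricCategory A]
  [MonoidalClosed A]

/-- If `Δ` agrees with the opposite of `Δ'` up to a chain homotopy, then the dual products of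
cocycles commute up to a coboundary. -/
theorem dualProduct_comm_of_homotopy {P P' Q Q' R R' Y Z : A} (y : Y ⟶ (ihom P).obj (𝟙_ A))
    (z : Z ⟶ (ihom Q).obj (𝟙_ A)) {f : P' ⟶ P} {g : Q' ⟶ Q} {k : R ⟶ R'}
    (hy : y ≫ (MonoidalClosed.pre f).app (𝟙_ A) = 0)
    (hz : z ≫ (MonoidalClosed.pre g).app (𝟙_ A) = 0) {Δ : R ⟶ P ⊗ Q} {Δ' : R ⟶ Q ⊗ P}
    {D₁ : R ⟶ P' ⊗ Q} {D₂ : R ⟶ P ⊗ Q'} {D₃ : R' ⟶ P ⊗ Q} {e a b c : ℤ}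
    (h : Δ = e • Δ' ≫ (β_ _ _).hom + a • D₁ ≫ (f ⊗ₘ 𝟙 Q) + b • D₂ ≫ (𝟙 P ⊗ₘ g) + c • k ≫ D₃) :
    (y ⊗ₘ z) ≫ dualProduct Δ = e • (y ⊗ₘ z) ≫ (β_ _ _).hom ≫ dualProduct Δ' +
      (c • (y ⊗ₘ z) ≫ dualProduct D₃) ≫ (MonoidalClosed.pre k).app (𝟙_ A) := by
  have := monoidalPreadditive (A := A)
  have h₁ : (y ⊗ₘ z) ≫ dualProduct (D₁ ≫ (f ⊗ₘ 𝟙 Q)) = 0 := by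
    rw [← pre_dualProduct, tensorHom_comp_tensorHom_assoc, hy]
    simp
  have h₂ : (y ⊗ₘ z) ≫ dualProduct (D₂ ≫ (𝟙 P ⊗ₘ g)) = 0 := by
    rw [← pre_dualProduct, tensorHom_comp_tensorHom_assoc, hz]
    simp
  rw [h, dualProduct_add, dualProduct_add, dualProduct_add]
  simp only [dualProduct_zsmul, Preadditive.comp_add, Preadditive.comp_zsmul, h₁, h₂, smul_zero,
    add_zero]
  rw [dualProduct_braiding, ← dualProduct_pre, Preadditive.zsmul_comp, Category.assoc]

end DualHomotopy

section HomologyComm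

variable {A : Type u₂} [Category.{v₂} A] [Abelian A] [MonoidalCategory A]
  [SymmetricCategory A] [MonoidalClosed A] {K : CochainComplex A ℕ} (M : LeibnizProduct K)

/-- A pair of cohomology classes lifts to a pair of cocycles, since tensor products with a fixed
object preserve epimorphisms in a closed category. -/
theorem epi_homologyπ_tensorHom (p q : ℕ) : Epi (K.homologyπ p ⊗ₘ K.homologyπ q) := by
  have h₁ : Epi (K.cycles p ◁ K.homologyπ q) :=
    inferInstanceAs (Epi ((tensorLeft (K.cycles p)).map (K.homologyπ q)))
  have h₂ : Epi (K.homology q ◁ K.homologyπ p) :=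
    inferInstanceAs (Epi ((tensorLeft (K.homology q)).map (K.homologyπ p)))
  have h₃ : K.homologyπ p ▷ K.homology q =
      (β_ _ _).hom ≫ K.homology q ◁ K.homologyπ p ≫ (β_ _ _).inv := by simp
  rw [tensorHom_def', h₃]
  infer_instance

/-- Products of cohomology classes commute up to the sign `e`, if the products of cocycles do so up
to coboundaries. -/
theorem LeibnizProduct.homologyMul_comm (p q n : ℕ) (hpq : p + q = n) (hqp : q + p = n) (e : ℤ)
    (i : ℕ) (x : K.cycles p ⊗ K.cycles q ⟶ K.X i)
    (h : (K.iCycles p ⊗ₘ K.iCycles q) ≫ M.mul p q n hpq =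
      e • (K.iCycles p ⊗ₘ K.iCycles q) ≫ (β_ _ _).hom ≫ M.mul q p n hqp + x ≫ K.d i n) :
    M.homologyMul p q n hpq = e • (β_ _ _).hom ≫ M.homologyMul q p n hqp := by
  have := epi_homologyπ_tensorHom (K := K) p q
  have hx := K.liftCycles_homologyπ_eq_zero_of_boundary (x ≫ K.d i n) (n + 1) (by simp) x rfl
  have hc : M.cyclesMul p q n hpq = e • (β_ _ _).hom ≫ M.cyclesMul q p n hqp +
      K.liftCycles (x ≫ K.d i n) (n + 1) (by simp) (by simp) := by
    rw [← cancel_mono (K.iCycles n)]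
    simp only [LeibnizProduct.cyclesMul, Preadditive.add_comp, Preadditive.zsmul_comp,
      Category.assoc, HomologicalComplex.liftCycles_i]
    rw [h, BraidedCategory.braiding_naturality_assoc]
  rw [← cancel_epi (K.homologyπ p ⊗ₘ K.homologyπ q), M.π_homologyMul, hc, Preadditive.add_comp, hx,
    add_zero, Preadditive.zsmul_comp, Preadditive.comp_zsmul,
    BraidedCategory.braiding_naturality_assoc, M.π_homologyMul, Category.assoc]

end HomologyComm

section MagnitudeComm

variable {V : Type u₁} [Category.{v₁} V] [CartesianMonoidalCategory V] [SymmetricCategory V]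
variable {A : Type u₂} [Category.{v₂} A] [MonoidalCategory A] [SymmetricCategory A]
variable (S : V ⥤ A) [S.Braided]
variable (X : Type w) [EnrichedCategory V X] [∀ k, HasCoproduct (summand S X k)]

/-- The diagonal of the magnitude nerve of a category enriched in a cartesian category. -/
def nerveCocommutativeDiagonal : CocommutativeDiagonal (simplicialNerve S X) where
  diag n := nerveDiagonal S X n
  map_diag f := nerveMap_nerveDiagonal S f.toOrderHom
  diag_braiding n := nerveDiagonal_braiding S X n

theorem vertexFace_simplicialNerve {m n : ℕ} (f : Fin (m + 1) →o Fin (n + 1)) (g : ℕ →o ℕ)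
    (h : ∀ v : Fin (m + 1), min (g v) n = (f v : ℕ)) :
    vertexFace (simplicialNerve S X) m n g = nerveMap S f := by
  change nerveMap S (vertexMap m n g).toOrderHom = _
  congr 1
  ext v
  exact h v

variable [MonoidalClosed A] [Abelian A]

theorem boundary_eq_alternatingFaces (n : ℕ) :
    boundary S X n = alternatingFaces (simplicialNerve S X) n := by
  rw [boundary, alternatingFaces, Finset.sum_range]
  refine Finset.sum_congr rfl fun i _ => ?_
  have h : vertexFace (simplicialNerve S X) n (n + 1) (skipHom i) = nerveMap S (skip n i) :=
    vertexFace_simplicialNerve S X (skip n i) (skipHom i) fun v => by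
      change _ = skipNat i v
      rw [skipNat_eq, skipHom_apply]
      grind
  rw [nerveFace_eq]
  exact congrArg ((-1 : ℤ) ^ (i : ℕ) • ·) h.symm

theorem coproduct_eq_split (p q n : ℕ) (h : p + q = n) : coproduct S X p q n h =
    (nerveCocommutativeDiagonal S X).split n p q OrderHom.id (shiftHom p) := by
  obtain rfl : n = q + p := by omega
  rw [coproduct_eq, CocommutativeDiagonal.split, vertexFace_simplicialNerve S X (front p q),
    vertexFace_simplicialNerve S X (back p q)]
  · rfl
  · intro v
    change min (p + v) (q + p) = v + p
    omega
  · intro v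
    change min (v : ℕ) (q + p) = v
    omega

theorem magnitudeCochains_d (n : ℕ) : (magnitudeCochains S X).d n (n + 1) =
    (MonoidalClosed.pre (boundary S X n)).app (𝟙_ A) := by
  simp only [magnitudeCochains, dualComplex, magnitudeChains, ChainComplex.of_d]
  rfl

/-- The cup-one homotopy of the magnitude nerve. -/
def nerveCupOne (p q n : ℕ) : nerve S X n ⟶ nerve S X p ⊗ nerve S X q :=
  (nerveCocommutativeDiagonal S X).cupOne p q n

/-- The coproduct of the magnitude nerve is cocommutative up to the cup-one homotopy. -/
theorem coproduct_braiding (p q n : ℕ) (h : p + q = n + 1) :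
    coproduct S X p q (n + 1) h =
      (-1 : ℤ) ^ (p * q) • coproduct S X q p (n + 1) (by omega) ≫ (β_ _ _).hom +
      (-1 : ℤ) ^ (p * q + 1) •
        nerveCupOne S X (p + 1) q (n + 1) ≫ (boundary S X p ⊗ₘ 𝟙 (nerve S X q)) +
      (-1 : ℤ) ^ (p * q + q) •
        nerveCupOne S X p (q + 1) (n + 1) ≫ (𝟙 (nerve S X p) ⊗ₘ boundary S X q) +
      (-1 : ℤ) ^ (p * q + q + 1) • boundary S X n ≫ nerveCupOne S X p q n := by
  have := monoidalPreadditive (A := A)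
  have key : (-1 : ℤ) ^ (q + 1) •
        nerveCupOne S X (p + 1) q (n + 1) ≫ boundary S X p ▷ nerve S X q +
      nerveCupOne S X p (q + 1) (n + 1) ≫ nerve S X p ◁ boundary S X q =
      boundary S X n ≫ nerveCupOne S X p q n +
      (-1 : ℤ) ^ q • ((-1 : ℤ) ^ (p * q) • coproduct S X p q (n + 1) h -
        coproduct S X q p (n + 1) (by omega) ≫ (β_ _ _).hom) := by
    rw [coproduct_eq_split, coproduct_eq_split, boundary_eq_alternatingFaces,
      boundary_eq_alternatingFaces, boundary_eq_alternatingFaces]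
    exact (nerveCocommutativeDiagonal S X).cupOne_boundary p q n h
  rw [tensorHom_id, id_tensorHom]
  have key' := congrArg ((-1 : ℤ) ^ (p * q + q) • ·) key
  obtain h | h := neg_one_pow_eq_or ℤ (p * q) <;> obtain h' | h' := neg_one_pow_eq_or ℤ q <;>
    simp only [pow_add, h, h', pow_one] at key' ⊢ <;>
    linear_combination (norm := module) (-1 : ℤ) • key'

/-- Products of cocycles commute up to sign and coboundaries. -/
theorem cocycles_mul_comm (p q n : ℕ) (hpq : p + q = n) (hqp : q + p = n) :
    ∃ (i : ℕ) (x : (magnitudeCochains S X).cycles p ⊗ (magnitudeCochains S X).cycles q ⟶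
        (magnitudeCochains S X).X i),
      ((magnitudeCochains S X).iCycles p ⊗ₘ (magnitudeCochains S X).iCycles q) ≫
          (magnitudeCochainsProduct S X).mul p q n hpq =
        (-1 : ℤ) ^ (p * q) •
          ((magnitudeCochains S X).iCycles p ⊗ₘ (magnitudeCochains S X).iCycles q) ≫
            (β_ _ _).hom ≫ (magnitudeCochainsProduct S X).mul q p n hqp +
          x ≫ (magnitudeCochains S X).d i n := by
  have := monoidalPreadditive (A := A)
  cases n with
  | zero =>
    obtain rfl : p = 0 := by omega
    obtain rfl : q = 0 := by omega
    -- In degree zero there are no coboundaries, and the coproduct is the diagonal itself.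
    refine ⟨0, 0, ?_⟩
    have h : coproduct S X 0 0 0 rfl ≫ (β_ _ _).hom = coproduct S X 0 0 0 rfl := by
      rw [coproduct_eq_split]
      refine ((nerveCocommutativeDiagonal S X).split_braiding 0 0 0 _ _).trans ?_
      exact (nerveCocommutativeDiagonal S X).split_congr (fun v _ => by simp [shiftHom_apply])
        (fun v _ => by simp [shiftHom_apply])
    have h' : (β_ _ _).hom ≫ dualProduct (coproduct S X 0 0 0 rfl) =
        dualProduct (coproduct S X 0 0 0 rfl) := by
      rw [← dualProduct_braiding, h]
    rw [zero_comp, add_zero, mul_zero, pow_zero, one_smul]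
    exact congrArg (_ ≫ ·) h'.symm
  | succ n =>
    have hd (k : ℕ) : (magnitudeCochains S X).iCycles k ≫
        (MonoidalClosed.pre (boundary S X k)).app (𝟙_ A) = 0 := by
      have h := (magnitudeCochains S X).iCycles_d k (k + 1)
      rw [magnitudeCochains_d] at h
      exact h
    have h := dualProduct_comm_of_homotopy _ _ (hd p) (hd q) (coproduct_braiding S X p q n hpq)
    rw [← magnitudeCochains_d] at h
    exact ⟨n, _, h⟩

end MagnitudeComm

end MagnitudeCohomology

end

theorem theorem5p1 {V : Type u₁} [Category.{v₁} V] [CartesianMonoidalCategory V]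
    [SymmetricCategory V] {A : Type u₂} [Category.{v₂} A] [Abelian A] [MonoidalCategory A]
    [SymmetricCategory A] [MonoidalClosed A] (S : V ⥤ A) [S.Braided]
    (X : Type w) [EnrichedCategory V X]
    [∀ k, HasCoproduct (MagnitudeCohomology.summand S X k)]
    (p q n : ℕ) (hpq : p + q = n) (hqp : q + p = n) :
    MagnitudeCohomology.magnitudeProduct S X p q n hpq =
      (-1 : ℤ) ^ (p * q) •
        ((β_ (MagnitudeCohomology.magnitudeCohomology S X p)
            (MagnitudeCohomology.magnitudeCohomology S X q)).hom ≫
          MagnitudeCohomology.magnitudeProduct S X q p n hqp) := by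
  obtain ⟨i, x, h⟩ := MagnitudeCohomology.cocycles_mul_comm S X p q n hpq hqp
  exact MagnitudeCohomology.LeibnizProduct.homologyMul_comm _ p q n hpq hqp _ i x h
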